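/- All graphs are finite, simple and have at least one vertex. A search tree on a connected graph $G$ is a rooted tree with vertex set $V(G)$ defined recursively: its root is some vertex $r\in V(G)$, and the children of $r$ are the roots of search trees on the connected components of $G-r$, one for each component. If $v$ is a child of $u$ in a search tree $T$, the $uv$-rotation of $T$ is the search tree $T'$ in which $u$ is a child of $v$; $v$ is a child of the parent of $u$ in $T$ (or the root, if $u$ was the root of $T$); every subtree of $u$ in $T$ other than the one rooted at $v$ remains a subtree of $u$; every subtree of $v$ in $T$ that contains a vertex adjacent to $u$ in $G$ becomes a subtree of $u$, and every other subtree of $v$ remains a subtree of $v$; nothing else changes. The rotation graph $\mathcal R(G)$ has the search trees on $G$ as its vertices, two of them being adjacent if and only if they differ by one rotation. For $v\in V(G)$, let $\widetilde G_v$ be the graph obtained from $G$ by adding a false twin of $v$, i.e. a new vertex $v'$ whose neighbours are exactly the neighbours of $v$ in $G$. Let $\chi$ denote the chromatic number. (a) Let $G$ be a non-complete connected graph and let $v\in V(G)$ be a universal vertex (i.e. adjacent to every other vertex). Then $\chi(\mathcal R(\widetilde G_v))=\chi(\mathcal R(G))$. (b) For all positive integers $p,q$ with $p\ge 2$ or $q\ge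 2$, the complete bipartite graph $K_{p,q}$ satisfies $\chi(\mathcal R(K_{p,q}))=3$. -/

import Mathlib

universe u

/-- A rooted tree with vertex set `V`, given by its root and its parent function (the root is the
only vertex without a parent); following parents leads from every vertex to the root. -/
@[ext]
structure RootedTreeOn (V : Type u) where
  root : V
  parent : V → Option V
  parent_eq_none_iff : ∀ v, parent v = none ↔ v = root
  reaches_root : ∀ v, Relation.ReflTransGen (fun a b => parent a = some b) v root

/-- The vertex set of the subtree `T|w`: the vertices from which one reaches `w` by
following parents, including `w` itself. -/
def RootedTreeOn.subtree {V : Type u} (T : RootedTreeOn V) (w : V) : Set V :=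
  {x | Relation.ReflTransGen (fun a b => T.parent a = some b) x w}

/-- `D` is the vertex set of a connected component of the subgraph of `G` induced by `S`. -/
def IsComponentOf {V : Type u} (G : SimpleGraph V) (S D : Set V) : Prop :=
  ∃ c : (G.induce S).ConnectedComponent, D = Subtype.val '' c.supp

/-- `IsSearchTreeOn G par C r`: on the vertex set `C`, the parent function `par` describes a search
tree with root `r` on the subgraph of `G` induced by `C`. That is, `r ∈ C`, and for each connected
component `D` of `G[C] - r` there is a vertex `child D`, a child of `r`, that is the root of
a search tree on `G[D]`. Every vertex of `C` other than `r` lies in exactly one such `D`, so all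
parents of vertices in `C \ {r}` are prescribed in this way. -/
inductive IsSearchTreeOn {V : Type u} (G : SimpleGraph V) (par : V → Option V) :
    Set V → V → Prop
  | node (C : Set V) (r : V) (child : Set V → V) (hr : r ∈ C)
      (hchild : ∀ D, IsComponentOf G (C \ {r}) D → par (child D) = some r)
      (hsub : ∀ D, IsComponentOf G (C \ {r}) D → IsSearchTreeOn G par D (child D)) :
      IsSearchTreeOn G par C r

/-- The search trees (elimination trees) on a connected graph `G`. -/
def SearchTree {V : Type u} (G : SimpleGraph V) : Type u :=
  {T : RootedTreeOn V // IsSearchTreeOn G T.parent Set.univ T.root}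

/-- `T'` is obtained from `T` by the `uv`-rotation, where `v` is a child of `u` in `T`. -/
structure IsRotation {V : Type u} (G : SimpleGraph V) (T T' : RootedTreeOn V) (u v : V) :
    Prop where
  /-- `v` is a child of `u` in `T` -/
  child : T.parent v = some u
  /-- `u` becomes a child of `v` -/
  parent_u : T'.parent u = some v
  /-- `v` becomes a child of the parent of `u`, or the root if `u` was the root -/
  parent_v : T'.parent v = T.parent u
  /-- the other subtrees of `u` remain subtrees of `u` -/
  subtree_u : ∀ w, w ≠ v → T.parent w = some u → T'.parent w = some u
  /-- a subtree of `v` with a vertex adjacent to `u` in `G` becomes a subtree of `u` -/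
  subtree_v_moved : ∀ w, T.parent w = some v → (∃ x ∈ T.subtree w, G.Adj u x) →
    T'.parent w = some u
  /-- the other subtrees of `v` remain subtrees of `v` -/
  subtree_v_kept : ∀ w, T.parent w = some v → (¬ ∃ x ∈ T.subtree w, G.Adj u x) →
    T'.parent w = some v
  /-- nothing else changes -/
  parent_other : ∀ w, w ≠ u → w ≠ v → T.parent w ≠ some u → T.parent w ≠ some v →
    T'.parent w = T.parent w

/-- The rotation graph of a connected graph `G`: two distinct search trees on `G` are adjacent if
one is obtained from the other by a rotation. -/
def rotationGraph {V : Type u} (G : SimpleGraph V) : SimpleGraph (SearchTree G) :=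
  SimpleGraph.fromRel fun T T' => ∃ u v, IsRotation G T.1 T'.1 u v

/-- The graph obtained from `G` by adding a false twin `none` of `v`: its neighbours are exactly
the neighbours of `v` in `G`; see the two facts below. -/
def addFalseTwin {V : Type u} (G : SimpleGraph V) (v : V) : SimpleGraph (Option V) :=
  G.comap fun x => x.getD v

theorem addFalseTwin_adj_some_some {V : Type u} (G : SimpleGraph V) (v a b : V) :
    (addFalseTwin G v).Adj (some a) (some b) ↔ G.Adj a b := Iff.rfl

theorem addFalseTwin_adj_none {V : Type u} (G : SimpleGraph V) (v : V) (x : Option V) :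
    (addFalseTwin G v).Adj none x ↔ ∃ a, x = some a ∧ G.Adj v a := by
  cases x <;> simp [addFalseTwin]

/-!
# Chromatic numbers of rotation graphs and false twins

A search tree is determined by its descendant relation, and the relations that occur are the partial
orders whose up-sets are chains, in which adjacent vertices are comparable and whose down-sets are
connected (`IsSearchOrder`; `SearchTree.isSearchOrder`, `IsSearchOrder.exists_searchTree`). In these
terms a rotation at a child `c` of `p` is a flip: `c` inherits the down-set of `p` and no vertex
other than `p` and `c` changes its down-set (`rotationGraph_adj_iff`). All further arguments are
about orders.

*Upper bound.* Let `v` be a vertex all of whose edges are dominating; universal vertices and all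
vertices of a complete bipartite graph are of this kind. In a search order of `addFalseTwin G v` the
two twins are either comparable or both leaves. Deleting the upper twin leaves a search order of
`G`. A flip that does not move the upper twin induces a flip there. A flip that does move it leaves
the order on the remaining vertices unchanged, and either exchanges the twins, or changes the size
of the down-set of the upper twin by one (as this twin is comparable with every vertex), or makes
the twins comparable or incomparable. Hence, if `G` has a colouring with `n ≥ 3` colours, one can
add to the colour of the order on `G` a second colour modulo `n`: it is `2` if the twins are
incomparable, and otherwise the parity of the size of that down-set plus the kind of the upper twin.
Each flip changes exactly one of the two summands (`IsFlip.changesOnePart`), which gives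
`rotationGraph_addFalseTwin_colorable`. Starting from a single edge, this colours the rotation
graphs of all complete bipartite graphs with three colours.

*Lower bound.* The search trees with the new twin at the root form a copy of the rotation graph of
`G` (`rotationGraph_colorable_of_addFalseTwin`). A connected graph that is not complete contains an
induced path on three vertices, and the five search trees of this path, placed below a fixed order
of all other vertices, form a five-cycle (`not_colorable_two_rotationGraph`); so at least three
colours are needed, which is also what the upper bound requires of `n`.
-/

/-! ### Connectivity of vertex sets -/

/-- Connectedness of `G[S]` as an induction principle: a set that meets `S` and is closed under
stepping to neighbours inside `S` contains all of `S`. -/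
theorem preconnected_induce_iff {V : Type*} {G : SimpleGraph V} {S : Set V} :
    (G.induce S).Preconnected ↔ ∀ K : Set V, (∃ x ∈ S, x ∈ K) →
      (∀ x ∈ S, x ∈ K → ∀ y ∈ S, G.Adj x y → y ∈ K) → ∀ y ∈ S, y ∈ K := by
  constructor
  · rintro h K ⟨x, hxS, hxK⟩ hcl y hyS
    have h1 := h ⟨x, hxS⟩ ⟨y, hyS⟩
    rw [SimpleGraph.reachable_iff_reflTransGen] at h1
    have key : ∀ z : S, Relation.ReflTransGen (G.induce S).Adj ⟨x, hxS⟩ z → (z : V) ∈ K := by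
      intro z hz
      induction hz with
      | refl => exact hxK
      | tail _ hbc ih => exact hcl _ (Subtype.property _) ih _ (Subtype.property _) hbc
    exact key _ h1
  · rintro h ⟨x, hx⟩ ⟨y, hy⟩
    have := h {z | ∃ hz : z ∈ S, (G.induce S).Reachable ⟨x, hx⟩ ⟨z, hz⟩}
      ⟨x, hx, hx, SimpleGraph.Reachable.refl _⟩ ?_ y hy
    · exact this.2
    · rintro a haS ⟨_, har⟩ b hb hab
      refine ⟨hb, har.trans (SimpleGraph.Adj.reachable ?_)⟩
      exact hab

theorem exists_adj_of_preconnected_induce {V : Type*} {G : SimpleGraph V} {S : Set V}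
    (h : (G.induce S).Preconnected) {x y : V} (hx : x ∈ S) (hy : y ∈ S) (hxy : x ≠ y) :
    ∃ z ∈ S, G.Adj x z := by
  by_contra! hc
  exact hxy (preconnected_induce_iff.1 h {x} ⟨x, hx, rfl⟩
    (fun a ha hax b hb hab => absurd hab (by rw [Set.mem_singleton_iff.1 hax]; exact hc b hb))
    y hy).symm

theorem preconnected_induce_univ_iff {V : Type*} {G : SimpleGraph V} :
    (G.induce Set.univ).Preconnected ↔ G.Preconnected :=
  (SimpleGraph.induceUnivIso G).preconnected_iff

theorem isComponentOf_iff {V : Type u} {G : SimpleGraph V} {S D : Set V} :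
    IsComponentOf G S D ↔ D ⊆ S ∧ D.Nonempty ∧ (G.induce D).Preconnected ∧
      ∀ x ∈ D, ∀ y ∈ S, G.Adj x y → y ∈ D := by
  constructor
  · rintro ⟨c, rfl⟩
    refine ⟨?_, c.nonempty_supp.image _, ?_, ?_⟩
    · rintro _ ⟨x, -, rfl⟩
      exact x.2
    · rw [preconnected_induce_iff]
      rintro K ⟨_, ⟨x, hx, rfl⟩, hxK⟩ hcl _ ⟨y, hy, rfl⟩
      have hr : (G.induce S).Reachable x y := c.reachable_of_mem_supp hx hy
      rw [SimpleGraph.reachable_iff_reflTransGen] at hr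
      have key : y ∈ c.supp ∧ (y : V) ∈ K := by
        clear hy
        induction hr with
        | refl => exact ⟨hx, hxK⟩
        | tail _ hbc ih =>
          have h1 := c.mem_supp_of_adj_mem_supp ih.1 hbc
          exact ⟨h1, hcl _ ⟨_, ih.1, rfl⟩ ih.2 _ ⟨_, h1, rfl⟩ hbc⟩
      exact key.2
    · rintro _ ⟨x, hx, rfl⟩ y hy hxy
      exact ⟨⟨y, hy⟩, c.mem_supp_of_adj_mem_supp hx (v := ⟨y, hy⟩) hxy, rfl⟩
  · rintro ⟨hDS, ⟨d, hd⟩, hcon, hcl⟩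
    refine ⟨(G.induce S).connectedComponentMk ⟨d, hDS hd⟩, ?_⟩
    ext x
    constructor
    · intro hx
      have hr := hcon ⟨x, hx⟩ ⟨d, hd⟩
      have := hr.map (SimpleGraph.induceHomOfLE G hDS).toHom
      exact ⟨⟨x, hDS hx⟩, SimpleGraph.ConnectedComponent.sound this, rfl⟩
    · rintro ⟨y, hy, rfl⟩
      have hr : (G.induce S).Reachable ⟨d, hDS hd⟩ y :=
        (SimpleGraph.ConnectedComponent.exact hy).symm
      rw [SimpleGraph.reachable_iff_reflTransGen] at hr
      clear hy
      induction hr with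
      | refl => exact hd
      | tail _ hbc ih => exact hcl _ ih _ (Subtype.property _) hbc

theorem exists_isComponentOf {V : Type u} {G : SimpleGraph V} {S : Set V} {x : V} (hx : x ∈ S) :
    ∃ D, IsComponentOf G S D ∧ x ∈ D :=
  ⟨_, ⟨(G.induce S).connectedComponentMk ⟨x, hx⟩, rfl⟩, ⟨x, hx⟩, rfl, rfl⟩

theorem IsComponentOf.eq_of_mem {V : Type u} {G : SimpleGraph V} {S D D' : Set V}
    (h : IsComponentOf G S D) (h' : IsComponentOf G S D') {x : V} (hx : x ∈ D) (hx' : x ∈ D') :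
    D = D' := by
  rw [isComponentOf_iff] at h h'
  apply Set.Subset.antisymm
  · exact preconnected_induce_iff.1 h.2.2.1 D' ⟨x, hx, hx'⟩
      fun a _ ha' b hb hab => h'.2.2.2 a ha' b (h.1 hb) hab
  · exact preconnected_induce_iff.1 h'.2.2.1 D ⟨x, hx', hx⟩
      fun a _ ha' b hb hab => h.2.2.2 a ha' b (h'.1 hb) hab

/-! ### Rooted trees as orders -/

namespace RootedTreeOn

variable {V : Type u} (T : RootedTreeOn V)

/-- `T.Desc x w`: the vertex `x` is a descendant of `w`, or `w` itself. -/
def Desc (x w : V) : Prop := x ∈ T.subtree w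

variable {T}

theorem Desc.refl (x : V) : T.Desc x x := Relation.ReflTransGen.refl

theorem Desc.trans {x y z : V} (h : T.Desc x y) (h' : T.Desc y z) : T.Desc x z :=
  Relation.ReflTransGen.trans h h'

theorem desc_of_parent {x p : V} (h : T.parent x = some p) : T.Desc x p :=
  Relation.ReflTransGen.single h

theorem desc_root (x : V) : T.Desc x T.root := T.reaches_root x

theorem Desc.eq_or_parent {x w : V} (h : T.Desc x w) :
    x = w ∨ ∃ p, T.parent x = some p ∧ T.Desc p w :=
  Relation.ReflTransGen.cases_head h

theorem parent_root : T.parent T.root = none := (T.parent_eq_none_iff _).2 rfl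

theorem Desc.induction {w : V} {P : V → Prop} (hw : P w)
    (hs : ∀ x p, T.parent x = some p → T.Desc p w → P p → P x) {x : V} (h : T.Desc x w) : P x := by
  unfold Desc subtree at h
  induction (show Relation.ReflTransGen (fun a b => T.parent a = some b) x w from h)
    using Relation.ReflTransGen.head_induction_on with
  | refl => exact hw
  | head h1 h2 ih => exact hs _ _ h1 h2 (ih h2)

/-- The number of steps to the root is well defined and drops by one at each parent step, so
following parents never returns to a vertex. -/
theorem exists_depth (T : RootedTreeOn V) :
    ∃ d : V → ℕ, ∀ x p, T.parent x = some p → d x = d p + 1 := by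
  classical
  have hex : ∀ x, ∃ n, ((fun o : Option V => o.bind T.parent)^[n]) (some x) = some T.root := by
    intro x
    refine Desc.induction (T := T) (w := T.root) (P := fun x => ∃ n,
      ((fun o : Option V => o.bind T.parent)^[n]) (some x) = some T.root) ⟨0, rfl⟩ ?_ (desc_root x)
    rintro x p hp - ⟨n, hn⟩
    exact ⟨n + 1, by rw [Function.iterate_succ_apply]; simpa [hp] using hn⟩
  refine ⟨fun x => Nat.find (hex x), fun x p hp => ?_⟩
  have hx0 : Nat.find (hex x) ≠ 0 := by
    intro h0
    have := Nat.find_spec (hex x)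
    rw [h0] at this
    simp only [Function.iterate_zero, id, Option.some.injEq] at this
    rw [this, parent_root] at hp
    cases hp
  have hstep : ∀ n, ((fun o : Option V => o.bind T.parent)^[n + 1]) (some x)
      = ((fun o : Option V => o.bind T.parent)^[n]) (some p) := by
    intro n
    rw [Function.iterate_succ_apply]
    simp [hp]
  apply le_antisymm
  · apply Nat.find_min'
    rw [hstep]
    exact Nat.find_spec (hex p)
  · obtain ⟨m, hm⟩ := Nat.exists_eq_succ_of_ne_zero hx0
    change Nat.find (hex p) + 1 ≤ Nat.find (hex x)
    rw [hm]
    apply Nat.succ_le_succ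
    apply Nat.find_min'
    rw [← hstep]
    have := Nat.find_spec (hex x)
    rwa [hm] at this

theorem Desc.antisymm {x y : V} (h : T.Desc x y) (h' : T.Desc y x) : x = y := by
  obtain ⟨d, hd⟩ := T.exists_depth
  have key : ∀ {w x : V}, T.Desc x w → x = w ∨ d w < d x := by
    intro w x h
    refine Desc.induction (T := T) (P := fun x => x = w ∨ d w < d x) (Or.inl rfl) ?_ h
    rintro x p hp - (rfl | h2)
    · right; rw [hd _ _ hp]; omega
    · right; rw [hd _ _ hp]; omega
  rcases key h with h1 | h1
  · exact h1
  rcases key h' with h2 | h2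
  · exact h2.symm
  · omega

theorem Desc.chain {x y z : V} (h : T.Desc x y) (h' : T.Desc x z) : T.Desc y z ∨ T.Desc z y := by
  refine Desc.induction (T := T) (w := y) (P := fun x => T.Desc x z → T.Desc y z ∨ T.Desc z y)
    (fun h => Or.inl h) ?_ h h'
  intro x p hp hpy ih hxz
  rcases hxz.eq_or_parent with rfl | ⟨p', hp', hpz⟩
  · exact Or.inr ((desc_of_parent hp).trans hpy)
  · rw [hp] at hp'
    cases hp'
    exact ih hpz

theorem parent_ne {x p : V} (h : T.parent x = some p) : x ≠ p := by
  obtain ⟨d, hd⟩ := T.exists_depth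
  rintro rfl
  have := hd _ _ h
  omega

theorem Desc.eq_or_of_parent {x p y : V} (h : T.parent x = some p) (hy : T.Desc x y) :
    x = y ∨ T.Desc p y := by
  rcases hy.eq_or_parent with h1 | ⟨q, hq, hqy⟩
  · exact Or.inl h1
  · rw [h] at hq
    cases hq
    exact Or.inr hqy

/-- The parent of `x` is the element covering `x` in the descendant order. -/
theorem parent_eq_some_iff {x p : V} :
    T.parent x = some p ↔ x ≠ p ∧ T.Desc x p ∧ ∀ y, T.Desc x y → x = y ∨ T.Desc p y := by
  constructor
  · exact fun h => ⟨parent_ne h, desc_of_parent h, fun y hy => hy.eq_or_of_parent h⟩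
  · rintro ⟨hne, hxp, hmin⟩
    rcases hxp.eq_or_parent with h1 | ⟨q, hq, hqp⟩
    · exact absurd h1 hne
    · rcases hmin q (desc_of_parent hq) with h2 | h2
      · exact absurd h2 (parent_ne hq)
      · rwa [← h2.antisymm hqp] at hq

theorem parent_eq_none_iff_desc {x : V} : T.parent x = none ↔ ∀ y, T.Desc y x := by
  rw [T.parent_eq_none_iff]
  constructor
  · rintro rfl y
    exact desc_root y
  · intro h
    exact (desc_root x).antisymm (h _)

theorem ext_of_desc {T' : RootedTreeOn V} (h : ∀ x w, T.Desc x w ↔ T'.Desc x w) : T = T' := by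
  have hp : ∀ x, T.parent x = T'.parent x := by
    intro x
    cases hx : T.parent x with
    | none =>
      rw [parent_eq_none_iff_desc] at hx
      exact (parent_eq_none_iff_desc.2 fun y => (h _ _).1 (hx y)).symm
    | some p =>
      rw [parent_eq_some_iff] at hx
      refine (parent_eq_some_iff.2 ?_).symm
      simpa only [← h] using hx
  refine RootedTreeOn.ext ?_ (funext hp)
  rw [← T'.parent_eq_none_iff, ← hp, T.parent_eq_none_iff]

end RootedTreeOn

/-! ### Search orders -/

/-- An order-theoretic encoding of search trees: `A x w` means that `x` is a descendant of `w`.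
The relation `A` is a partial order in which the elements above a given one form a chain, adjacent
vertices are comparable, and the elements below a given one induce a connected subgraph. -/
structure IsSearchOrder {V : Type u} (G : SimpleGraph V) (A : V → V → Prop) : Prop where
  refl : ∀ x, A x x
  antisymm : ∀ x y, A x y → A y x → x = y
  trans : ∀ x y z, A x y → A y z → A x z
  chain : ∀ x y z, A x y → A x z → A y z ∨ A z y
  adj : ∀ x y, G.Adj x y → A x y ∨ A y x
  conn : ∀ w, (G.induce {x | A x w}).Preconnected

open RootedTreeOn in
theorem IsSearchTreeOn.desc_root {V : Type u} {G : SimpleGraph V} {T : RootedTreeOn V} {C : Set V}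
    {r : V} (h : IsSearchTreeOn G T.parent C r) : r ∈ C ∧ ∀ x ∈ C, T.Desc x r := by
  induction h with
  | node C r child hr hchild hsub ih =>
    refine ⟨hr, fun x hx => ?_⟩
    by_cases hxr : x = r
    · rw [hxr]; exact Desc.refl r
    · obtain ⟨D, hD, hxD⟩ := exists_isComponentOf (G := G) (S := C \ {r}) ⟨hx, hxr⟩
      exact ((ih D hD).2 x hxD).trans (desc_of_parent (hchild D hD))

open RootedTreeOn in
theorem IsSearchTreeOn.adj_comparable {V : Type u} {G : SimpleGraph V} {T : RootedTreeOn V}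
    {C : Set V} {r : V} (h : IsSearchTreeOn G T.parent C r) :
    ∀ x ∈ C, ∀ y ∈ C, G.Adj x y → T.Desc x y ∨ T.Desc y x := by
  induction h with
  | node C r child hr hchild hsub ih =>
    have hroot := (IsSearchTreeOn.node C r child hr hchild hsub).desc_root.2
    intro x hx y hy hxy
    by_cases hxr : x = r
    · rw [hxr]; exact Or.inr (hroot y hy)
    by_cases hyr : y = r
    · rw [hyr]; exact Or.inl (hroot x hx)
    obtain ⟨D, hD, hxD⟩ := exists_isComponentOf (G := G) (S := C \ {r}) ⟨hx, hxr⟩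
    exact ih D hD x hxD y ((isComponentOf_iff.1 hD).2.2.2 x hxD y ⟨hy, hyr⟩ hxy) hxy

open RootedTreeOn in
theorem IsSearchTreeOn.subtree_connected {V : Type u} {G : SimpleGraph V} {T : RootedTreeOn V}
    {C : Set V} {r : V} (h : IsSearchTreeOn G T.parent C r) (hC : T.subtree r = C)
    (hcon : (G.induce C).Preconnected) :
    ∀ w ∈ C, (G.induce (T.subtree w)).Preconnected := by
  induction h with
  | node C r child hr hchild hsub ih =>
    intro w hw
    by_cases hwr : w = r
    · rw [hwr, hC]; exact hcon
    obtain ⟨D, hD, hwD⟩ := exists_isComponentOf (G := G) (S := C \ {r}) ⟨hw, hwr⟩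
    refine ih D hD ?_ (isComponentOf_iff.1 hD).2.2.1 w hwD
    apply Set.Subset.antisymm
    · -- a descendant of `child D` lies in some component `D'`; both children of `r` are above it
      intro x hx
      have hxr : T.Desc x r := Desc.trans hx (desc_of_parent (hchild D hD))
      have hne : x ≠ r := by
        rintro rfl
        exact parent_ne (hchild D hD) ((desc_of_parent (hchild D hD)).antisymm hx)
      obtain ⟨D', hD', hxD'⟩ := exists_isComponentOf (G := G) (S := C \ {r})
        ⟨by rw [← hC]; exact hxr, hne⟩
      have hx' := (hsub D' hD').desc_root.2 x hxD'
      have heq : child D = child D' := by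
        rcases Desc.chain hx hx' with h1 | h1
        · rcases h1.eq_or_of_parent (hchild D hD) with h2 | h2
          · exact h2
          · exact absurd (h2.antisymm (desc_of_parent (hchild D' hD'))).symm
              (parent_ne (hchild D' hD'))
        · rcases h1.eq_or_of_parent (hchild D' hD') with h2 | h2
          · exact h2.symm
          · exact absurd (h2.antisymm (desc_of_parent (hchild D hD))).symm
              (parent_ne (hchild D hD))
      have hDD' : D = D' := hD.eq_of_mem hD' (hsub D hD).desc_root.1
        (by rw [heq]; exact (hsub D' hD').desc_root.1)
      rwa [hDD']
    · exact (hsub D hD).desc_root.2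

/-- The descendant relation of a search tree. -/
def SearchTree.Desc {V : Type u} {G : SimpleGraph V} (T : SearchTree G) : V → V → Prop :=
  T.1.Desc

theorem SearchTree.isSearchOrder {V : Type u} {G : SimpleGraph V} (hG : G.Preconnected)
    (T : SearchTree G) : IsSearchOrder G T.Desc where
  refl := RootedTreeOn.Desc.refl
  antisymm _ _ := RootedTreeOn.Desc.antisymm
  trans _ _ _ := RootedTreeOn.Desc.trans
  chain _ _ _ := RootedTreeOn.Desc.chain
  adj x y := T.2.adj_comparable x trivial y trivial
  conn w := T.2.subtree_connected
    (Set.eq_univ_of_forall RootedTreeOn.desc_root) (preconnected_induce_univ_iff.2 hG) w trivial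

theorem SearchTree.ext_of_desc {V : Type u} {G : SimpleGraph V} {T T' : SearchTree G}
    (h : ∀ x w, T.Desc x w ↔ T'.Desc x w) : T = T' :=
  Subtype.ext (RootedTreeOn.ext_of_desc h)

namespace IsSearchOrder

variable {V : Type u} {G : SimpleGraph V} {A : V → V → Prop}

theorem wellFounded_lt [Finite V] (h : IsSearchOrder G A) :
    WellFounded fun x y => A x y ∧ x ≠ y :=
  haveI : IsTrans V fun x y => A x y ∧ x ≠ y := ⟨fun _ _ _ hxy hyz =>
    ⟨h.trans _ _ _ hxy.1 hyz.1, fun he => hxy.2 (h.antisymm _ _ hxy.1 (he ▸ hyz.1))⟩⟩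
  haveI : Std.Irrefl fun x y => A x y ∧ x ≠ y := ⟨fun _ hx => hx.2 rfl⟩
  Finite.wellFounded_of_trans_of_irrefl _

theorem wellFounded_gt [Finite V] (h : IsSearchOrder G A) :
    WellFounded fun x y => A y x ∧ x ≠ y :=
  haveI : IsTrans V fun x y => A y x ∧ x ≠ y := ⟨fun _ _ _ hxy hyz =>
    ⟨h.trans _ _ _ hyz.1 hxy.1, fun he => hxy.2 (h.antisymm _ _ (he ▸ hyz.1) hxy.1)⟩⟩
  haveI : Std.Irrefl fun x y => A y x ∧ x ≠ y := ⟨fun _ hx => hx.2 rfl⟩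
  Finite.wellFounded_of_trans_of_irrefl _

theorem exists_top [Finite V] (h : IsSearchOrder G A) (hG : G.Connected) : ∃ r, ∀ x, A x r := by
  have := hG.nonempty
  obtain ⟨r, -, hr⟩ := h.wellFounded_gt.has_min Set.univ Set.univ_nonempty
  have hr : ∀ x, A r x → x = r := fun x hx => by
    by_contra hne
    exact hr x trivial ⟨hx, hne⟩
  refine ⟨r, fun x => preconnected_induce_iff.1 (preconnected_induce_univ_iff.2 hG.preconnected)
    {x | A x r} ⟨r, trivial, h.refl r⟩ ?_ x trivial⟩
  intro a _ (ha : A a r) b _ hab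
  rcases h.adj _ _ hab with h1 | h1
  · rcases h.chain _ _ _ ha h1 with h2 | h2
    · rw [hr b h2]; exact h.refl r
    · exact h2
  · exact h.trans _ _ _ h1 ha

theorem exists_cover [Finite V] (h : IsSearchOrder G A) {x w : V} (hxw : A x w) (hne : x ≠ w) :
    ∃ p, x ≠ p ∧ A x p ∧ ∀ y, A x y → x = y ∨ A p y := by
  obtain ⟨p, ⟨hp1, hp2⟩, hp⟩ := h.wellFounded_lt.has_min {p | A x p ∧ x ≠ p} ⟨w, hxw, hne⟩
  refine ⟨p, hp2, hp1, fun y hy => ?_⟩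
  by_cases hxy : x = y
  · exact Or.inl hxy
  · rcases h.chain _ _ _ hp1 hy with h1 | h1
    · exact Or.inr h1
    · by_cases hyp : y = p
      · rw [hyp]; exact Or.inr (h.refl p)
      · exact absurd ⟨h1, hyp⟩ (hp y ⟨hy, hxy⟩)

/-- Below `w` and above `x` there is a child of `w`. -/
theorem exists_cocover [Finite V] (h : IsSearchOrder G A) {x w : V} (hxw : A x w) (hne : x ≠ w) :
    ∃ c, A x c ∧ c ≠ w ∧ A c w ∧ ∀ y, A c y → c = y ∨ A w y := by
  obtain ⟨c, ⟨hc1, hc2, hc3⟩, hc⟩ :=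
    h.wellFounded_gt.has_min {c | A x c ∧ A c w ∧ c ≠ w} ⟨x, h.refl x, hxw, hne⟩
  refine ⟨c, hc1, hc3, hc2, fun y hy => ?_⟩
  rcases h.chain _ _ _ hc2 hy with h1 | h1
  · exact Or.inr h1
  · by_cases hyw : y = w
    · rw [hyw]; exact Or.inr (h.refl w)
    by_cases hyc : c = y
    · exact Or.inl hyc
    · exact absurd ⟨hy, fun h => hyc h.symm⟩ (hc y ⟨h.trans _ _ _ hc1 hy, h1, hyw⟩)

/-- A component of what is left below `w` after removing `w` is the set below a child of `w`. -/
theorem exists_child_of_isComponentOf [Finite V] (h : IsSearchOrder G A) {w : V} {D : Set V}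
    (hD : IsComponentOf G ({x | A x w} \ {w}) D) :
    ∃ c, D = {x | A x c} ∧ w ≠ c ∧ A c w ∧ ∀ y, A c y → c = y ∨ A w y := by
  have hD' := isComponentOf_iff.1 hD
  obtain ⟨x, hx⟩ := hD'.2.1
  obtain ⟨c, hxc, hcw, hcw', hc⟩ := h.exists_cocover (hD'.1 hx).1 (hD'.1 hx).2
  refine ⟨c, hD.eq_of_mem (isComponentOf_iff.2 ⟨?_, ⟨c, h.refl c⟩, h.conn c, ?_⟩) hx hxc,
    hcw.symm, hcw', hc⟩
  · intro z hz
    refine ⟨h.trans _ _ _ hz hcw', ?_⟩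
    rintro rfl
    exact hcw (h.antisymm _ _ hcw' hz)
  · rintro y hy z ⟨hzw, hzne⟩ hyz
    rcases h.adj _ _ hyz with h1 | h1
    · rcases h.chain _ _ _ hy h1 with h2 | h2
      · rcases hc z h2 with h3 | h3
        · rw [← h3]; exact h.refl c
        · exact absurd (h.antisymm _ _ hzw h3) hzne
      · exact h2
    · exact h.trans _ _ _ h1 hy

/-- Every search order of a connected graph is the descendant relation of a search tree. -/
theorem exists_searchTree [Finite V] (h : IsSearchOrder G A) (hG : G.Connected) :
    ∃ T : SearchTree G, ∀ x w, T.Desc x w ↔ A x w := by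
  classical
  obtain ⟨r, hr⟩ := h.exists_top hG
  have hpar : ∀ x, ∃ o : Option V, (x = r → o = none) ∧
      (x ≠ r → ∃ p, o = some p ∧ x ≠ p ∧ A x p ∧ ∀ y, A x y → x = y ∨ A p y) := by
    intro x
    by_cases hx : x = r
    · exact ⟨none, fun _ => rfl, fun h => absurd hx h⟩
    · obtain ⟨p, hp⟩ := h.exists_cover (hr x) hx
      exact ⟨some p, fun h => absurd h hx, fun _ => ⟨p, rfl, hp⟩⟩
  choose par hpar1 hpar2 using hpar
  have hsome : ∀ x p, par x = some p ↔ x ≠ p ∧ A x p ∧ ∀ y, A x y → x = y ∨ A p y := by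
    intro x p
    constructor
    · intro hp
      by_cases hx : x = r
      · rw [hpar1 x hx] at hp
        cases hp
      · obtain ⟨p', hp', hp''⟩ := hpar2 x hx
        rw [hp'] at hp
        cases hp
        exact hp''
    · rintro ⟨h1, h2, h3⟩
      have hx : x ≠ r := by
        rintro rfl
        exact h1 (h.antisymm _ _ h2 (hr p))
      obtain ⟨p', hp', h1', h2', h3'⟩ := hpar2 x hx
      rw [hp', h.antisymm p' p ((h3' p h2).resolve_left h1) ((h3 p' h2').resolve_left h1')]
  have hdesc : ∀ x w, Relation.ReflTransGen (fun a b => par a = some b) x w ↔ A x w := by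
    intro x w
    constructor
    · intro hxw
      induction hxw with
      | refl => exact h.refl x
      | tail _ hbc ih => exact h.trans _ _ _ ih ((hsome _ _).1 hbc).2.1
    · induction x using h.wellFounded_gt.induction with
      | _ x ih =>
        intro hxw
        by_cases hne : x = w
        · rw [hne]
        · obtain ⟨p, hp⟩ := h.exists_cover hxw hne
          exact Relation.ReflTransGen.head ((hsome _ _).2 hp)
            (ih p ⟨hp.2.1, hp.1.symm⟩ ((hp.2.2 w hxw).resolve_left hne))
  have hsearch : ∀ w, IsSearchTreeOn G par {x | A x w} w := by
    intro w
    induction w using h.wellFounded_lt.induction with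
    | _ w ih =>
      have hc : ∀ D : Set V, ∃ c, IsComponentOf G ({x | A x w} \ {w}) D →
          D = {x | A x c} ∧ w ≠ c ∧ A c w ∧ ∀ y, A c y → c = y ∨ A w y := by
        intro D
        by_cases hD : IsComponentOf G ({x | A x w} \ {w}) D
        · obtain ⟨c, hc⟩ := h.exists_child_of_isComponentOf hD
          exact ⟨c, fun _ => hc⟩
        · exact ⟨w, fun h => absurd h hD⟩
      choose child hchild using hc
      refine IsSearchTreeOn.node _ w child (h.refl w) (fun D hD => ?_) (fun D hD => ?_)
      · obtain ⟨-, h1, h2⟩ := hchild D hD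
        exact (hsome _ _).2 ⟨h1.symm, h2⟩
      · obtain ⟨h0, h1, h2, -⟩ := hchild D hD
        have := ih (child D) ⟨h2, h1.symm⟩
        rwa [← h0] at this
  have huniv : {x | A x r} = Set.univ := Set.eq_univ_of_forall hr
  refine ⟨⟨⟨r, par, fun x => ⟨fun hx => ?_, hpar1 x⟩, fun x => (hdesc x r).2 (hr x)⟩,
    by simpa only [huniv] using hsearch r⟩, hdesc⟩
  by_contra hne
  obtain ⟨p, hp, -⟩ := hpar2 x hne
  rw [hx] at hp
  cases hp

end IsSearchOrder

/-! ### Rotations as flips of search orders -/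

/-- `IsFlip A A' p c`: the order-theoretic form of a rotation. The vertex `c` is a child of `p` in
`A`; in `A'` the vertex `c` has the descendants that `p` had in `A`; the descendants of all vertices
other than `p` and `c` are the same in both. Connectivity forces the descendants of `p` in `A'`. -/
structure IsFlip {V : Type u} (A A' : V → V → Prop) (p c : V) : Prop where
  ne : c ≠ p
  le : A c p
  cover : ∀ y, A c y → c = y ∨ A p y
  top_iff : ∀ x, A' x c ↔ A x p
  other : ∀ w, w ≠ p → w ≠ c → ∀ x, A' x w ↔ A x w

theorem IsFlip.symm {V : Type u} {G : SimpleGraph V} {A A' : V → V → Prop} {p c : V}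
    (h : IsFlip A A' p c) (hA : IsSearchOrder G A) (hA' : IsSearchOrder G A') :
    IsFlip A' A c p where
  ne := h.ne.symm
  le := (h.top_iff p).2 (hA.refl p)
  cover y hy := by
    by_cases hyp : p = y
    · exact Or.inl hyp
    by_cases hyc : y = c
    · rw [hyc]; exact Or.inr (hA'.refl c)
    rw [h.other y (Ne.symm hyp) hyc] at hy ⊢
    exact Or.inr (hA.trans _ _ _ h.le hy)
  top_iff x := (h.top_iff x).symm
  other w h1 h2 x := (h.other w h2 h1 x).symm

namespace IsSearchOrder

variable {V : Type u} {G : SimpleGraph V} {A : V → V → Prop}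

/-- A vertex is adjacent to some descendant of each of its children. -/
theorem exists_adj_of_cover (h : IsSearchOrder G A) {c p : V} (hne : c ≠ p) (hcp : A c p)
    (hc : ∀ y, A c y → c = y ∨ A p y) : ∃ x, A x c ∧ G.Adj p x := by
  by_contra! hno
  have := preconnected_induce_iff.1 (h.conn p) {x | A x c} ⟨c, hcp, h.refl c⟩ ?_ p (h.refl p)
  · exact hne (h.antisymm _ _ hcp this)
  intro a _ (hac : A a c) b (hbp : A b p) hab
  rcases h.adj _ _ hab with h1 | h1
  · rcases h.chain _ _ _ hac h1 with h2 | h2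
    · rcases hc b h2 with h3 | h3
      · rw [← h3]; exact h.refl c
      · rw [h.antisymm _ _ hbp h3] at hab
        exact absurd hab.symm (hno a hac)
    · exact h2
  · exact h.trans _ _ _ h1 hac

end IsSearchOrder

open RootedTreeOn in
/-- A rotation does not change the descendants of vertices not involved, and moves those of `u`
to `v`. -/
theorem IsRotation.isFlip {V : Type u} {G : SimpleGraph V} {T T' : RootedTreeOn V} {u v : V}
    (h : IsRotation G T T' u v) : IsFlip T.Desc T'.Desc u v := by
  have hvu : v ≠ u := parent_ne h.child
  have hvu' : T.Desc v u := desc_of_parent h.child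
  have huv' : T'.Desc u v := desc_of_parent h.parent_u
  -- the new parent of a vertex other than `u` and `v`
  have hstep : ∀ x, x ≠ u → x ≠ v → T'.parent x = T.parent x ∨
      ((T.parent x = some u ∨ T.parent x = some v) ∧
        (T'.parent x = some u ∨ T'.parent x = some v)) := by
    intro x hxu hxv
    by_cases h1 : T.parent x = some u
    · exact Or.inl (by rw [h1, h.subtree_u x hxv h1])
    by_cases h2 : T.parent x = some v
    · refine Or.inr ⟨Or.inr h2, ?_⟩
      by_cases h3 : ∃ y ∈ T.subtree x, G.Adj u y
      · exact Or.inl (h.subtree_v_moved x h2 h3)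
      · exact Or.inr (h.subtree_v_kept x h2 h3)
    · exact Or.inl (h.parent_other x hxu hxv h1 h2)
  refine ⟨hvu, hvu', fun y hy => hy.eq_or_of_parent h.child, fun x => ⟨fun hx => ?_, fun hx => ?_⟩,
    fun w hwu hwv x => ⟨fun hx => ?_, fun hx => ?_⟩⟩
  · refine Desc.induction (T := T') (P := fun x => T.Desc x u) hvu' ?_ hx
    intro x p hp _ ih
    by_cases hxu : x = u
    · rw [hxu]; exact Desc.refl u
    by_cases hxv : x = v
    · rw [hxv]; exact hvu'
    rcases hstep x hxu hxv with h1 | ⟨h1 | h1, -⟩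
    · exact (desc_of_parent (h1 ▸ hp)).trans ih
    · exact desc_of_parent h1
    · exact (desc_of_parent h1).trans hvu'
  · refine Desc.induction (T := T) (P := fun x => T'.Desc x v) huv' ?_ hx
    intro x p hp _ ih
    by_cases hxu : x = u
    · rw [hxu]; exact huv'
    by_cases hxv : x = v
    · rw [hxv]; exact Desc.refl v
    rcases hstep x hxu hxv with h1 | ⟨-, h1 | h1⟩
    · exact (desc_of_parent (h1.trans hp)).trans ih
    · exact (desc_of_parent h1).trans huv'
    · exact desc_of_parent h1
  · refine Desc.induction (T := T') (P := fun x => T.Desc x w) (Desc.refl w) ?_ hx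
    intro x p hp _ ih
    by_cases hxu : x = u
    · subst hxu
      rw [h.parent_u] at hp
      cases hp
      exact (ih.eq_or_of_parent h.child).resolve_left hwv.symm
    by_cases hxv : x = v
    · subst hxv
      rw [h.parent_v] at hp
      exact (hvu'.trans (desc_of_parent hp)).trans ih
    rcases hstep x hxu hxv with h1 | ⟨h1, h2⟩
    · exact (desc_of_parent (h1 ▸ hp)).trans ih
    · have hu : T.Desc u w := by
        rcases h2 with h2 | h2
        · rw [hp] at h2; cases h2; exact ih
        · rw [hp] at h2; cases h2
          exact (ih.eq_or_of_parent h.child).resolve_left hwv.symm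
      rcases h1 with h1 | h1
      · exact (desc_of_parent h1).trans hu
      · exact ((desc_of_parent h1).trans hvu').trans hu
  · refine Desc.induction (T := T) (P := fun x => T'.Desc x w) (Desc.refl w) ?_ hx
    intro x p hp _ ih
    by_cases hxu : x = u
    · subst hxu
      rw [← h.parent_v] at hp
      exact (huv'.trans (desc_of_parent hp)).trans ih
    by_cases hxv : x = v
    · subst hxv
      rw [h.child] at hp
      cases hp
      exact (ih.eq_or_of_parent h.parent_u).resolve_left hwu.symm
    rcases hstep x hxu hxv with h1 | ⟨h1, h2⟩
    · exact (desc_of_parent (h1.trans hp)).trans ih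
    · have hv : T'.Desc v w := by
        rcases h1 with h1 | h1
        · rw [hp] at h1; cases h1
          exact (ih.eq_or_of_parent h.parent_u).resolve_left hwu.symm
        · rw [hp] at h1; cases h1; exact ih
      rcases h2 with h2 | h2
      · exact ((desc_of_parent h2).trans huv').trans hv
      · exact (desc_of_parent h2).trans hv

open RootedTreeOn in
/-- For search trees, the change of the descendant relation determines the rotation: a child of `v`
moves to `u` exactly when its subtree has a neighbour of `u`, as subtrees are connected and
adjacent vertices comparable. -/
theorem IsFlip.isRotation {V : Type u} [Finite V] {G : SimpleGraph V} {T T' : RootedTreeOn V}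
    {u v : V} (hA : IsSearchOrder G T.Desc) (hA' : IsSearchOrder G T'.Desc)
    (h : IsFlip T.Desc T'.Desc u v) : IsRotation G T T' u v := by
  obtain ⟨hvu, hle, hcov, htop, hoth⟩ := h
  have huv' : T'.Desc u v := (htop u).2 (Desc.refl u)
  have hnvu' : ¬ T'.Desc v u := fun h => hvu (h.antisymm huv')
  -- a vertex whose subtree is untouched and has a neighbour of `u` ends up below `u`
  have hmove : ∀ w, w ≠ u → w ≠ v → ¬ T.Desc u w → (∃ x, T.Desc x w ∧ G.Adj u x) →
      T'.Desc w u := by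
    rintro w hwu hwv hnuw ⟨x, hxw, hux⟩
    have hxw' := (hoth w hwu hwv x).2 hxw
    have hnuw' : ¬ T'.Desc u w := fun h => hnuw ((hoth w hwu hwv u).1 h)
    rcases hA'.adj _ _ hux with h1 | h1
    · exact absurd (h1.trans hxw') hnuw'
    · exact (hxw'.chain h1).resolve_right hnuw'
  -- the elements above `v` in the old tree
  have habove : ∀ y, T.Desc v y → y ≠ v → T'.Desc u y ∧ (y ≠ u → T'.Desc v y) := by
    intro y hy hyv
    by_cases hyu : y = u
    · rw [hyu]; exact ⟨Desc.refl u, fun h => absurd rfl h⟩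
    · have := (hcov y hy).resolve_left hyv.symm
      exact ⟨(hoth y hyu hyv u).2 this, fun _ => (hoth y hyu hyv v).2 hy⟩
  have hchild : ∀ w, w ≠ u → w ≠ v → (T.parent w = some u ∨ T.parent w = some v) →
      T'.Desc w u → T'.parent w = some u := by
    intro w hwu hwv hpar hwu'
    refine parent_eq_some_iff.2 ⟨hwu, hwu', fun y hy => ?_⟩
    by_cases hyw : w = y
    · exact Or.inl hyw
    right
    by_cases hyu : y = u
    · rw [hyu]; exact Desc.refl u
    by_cases hyv : y = v
    · rw [hyv]; exact huv'
    have hy1 := (hoth y hyu hyv w).1 hy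
    have hy2 : T.Desc u y := by
      rcases hpar with hpar | hpar
      · exact (hy1.eq_or_of_parent hpar).resolve_left hyw
      · exact (hcov y ((hy1.eq_or_of_parent hpar).resolve_left hyw)).resolve_left (Ne.symm hyv)
    exact (hoth y hyu hyv u).2 hy2
  have hpv : T.parent v = some u := parent_eq_some_iff.2 ⟨hvu, hle, hcov⟩
  refine ⟨hpv, ?_, ?_, ?_, ?_, ?_, ?_⟩
  · refine parent_eq_some_iff.2 ⟨hvu.symm, huv', fun y hy => ?_⟩
    by_cases hyu : u = y
    · exact Or.inl hyu
    right
    by_cases hyv : y = v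
    · rw [hyv]; exact Desc.refl v
    have hy1 := (hoth y (Ne.symm hyu) hyv u).1 hy
    exact (hoth y (Ne.symm hyu) hyv v).2 (hle.trans hy1)
  · cases hu : T.parent u with
    | none =>
      rw [parent_eq_none_iff_desc] at hu ⊢
      exact fun y => (htop y).2 (hu y)
    | some p =>
      have hup := desc_of_parent hu
      have hpu : u ≠ p := parent_ne hu
      have hpv' : p ≠ v := by
        rintro rfl
        exact hvu (hle.antisymm hup)
      refine parent_eq_some_iff.2 ⟨hpv'.symm, (hoth p hpu.symm hpv' v).2 (hle.trans hup),
        fun y hy => ?_⟩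
      by_cases hyv : v = y
      · exact Or.inl hyv
      right
      have hyu : y ≠ u := by
        rintro rfl
        exact hnvu' hy
      have h1 := (hcov y ((hoth y hyu (Ne.symm hyv) v).1 hy)).resolve_left hyv
      exact (hoth y hyu (Ne.symm hyv) p).2 ((h1.eq_or_of_parent hu).resolve_left hyu.symm)
  · intro w hwv hw
    have hwu : w ≠ u := parent_ne hw
    refine hchild w hwu hwv (Or.inl hw) (hmove w hwu hwv ?_ ?_)
    · exact fun h => hwu ((desc_of_parent hw).antisymm h)
    · obtain ⟨_, h2, h3⟩ := parent_eq_some_iff.1 hw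
      exact hA.exists_adj_of_cover hwu h2 h3
  · intro w hw hx
    have hwv : w ≠ v := parent_ne hw
    have hwu : w ≠ u := by
      rintro rfl
      exact hvu (hle.antisymm (desc_of_parent hw))
    refine hchild w hwu hwv (Or.inr hw) (hmove w hwu hwv ?_ hx)
    exact fun h => hwv ((desc_of_parent hw).antisymm (hle.trans h))
  · intro w hw hx
    have hwv : w ≠ v := parent_ne hw
    have hwu : w ≠ u := by
      rintro rfl
      exact hvu (hle.antisymm (desc_of_parent hw))
    refine parent_eq_some_iff.2 ⟨hwv, (htop w).2 ((desc_of_parent hw).trans hle), fun y hy => ?_⟩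
    by_cases hyw : w = y
    · exact Or.inl hyw
    right
    by_cases hyv : y = v
    · rw [hyv]; exact Desc.refl v
    by_cases hyu : y = u
    · -- `w` cannot end up below `u`: it would be a child of `u` itself, and its subtree would
      -- contain a neighbour of `u`
      exfalso
      subst hyu
      obtain ⟨c, hwc, hcy, hcy', hc⟩ := hA'.exists_cocover hy hwu
      have hcv : c ≠ v := by
        rintro rfl
        exact hnvu' hcy'
      have hwc1 := (hoth c hcy hcv w).1 hwc
      rcases hwc1.eq_or_of_parent hw with h1 | h1
      · subst h1
        obtain ⟨x, hxw, hux⟩ := hA'.exists_adj_of_cover hcy hcy' hc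
        exact hx ⟨x, (hoth w hcy hcv x).1 hxw, hux⟩
      · have h2 := (hcov c h1).resolve_left hcv.symm
        exact hcy (hcy'.antisymm ((hoth c hcy hcv y).2 h2))
    · have h1 := (hoth y hyu hyv w).1 hy
      exact (habove y ((h1.eq_or_of_parent hw).resolve_left hyw) hyv).2 hyu
  · intro w hwu hwv h1 h2
    cases hw : T.parent w with
    | none =>
      rw [parent_eq_none_iff_desc] at hw ⊢
      exact fun y => (hoth w hwu hwv y).2 (hw y)
    | some p =>
      have hpu : p ≠ u := by
        rintro rfl
        exact h1 hw
      have hpv' : p ≠ v := by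
        rintro rfl
        exact h2 hw
      have hwp := (hoth p hpu hpv' w).2 (desc_of_parent hw)
      refine parent_eq_some_iff.2 ⟨parent_ne hw, hwp, fun y hy => ?_⟩
      by_cases hyw : w = y
      · exact Or.inl hyw
      right
      by_cases hyv : y = v
      · rw [hyv] at hy ⊢
        exact (htop p).2 ((((htop w).1 hy).eq_or_of_parent hw).resolve_left hwu)
      by_cases hyu : y = u
      · rw [hyu] at hy ⊢
        rcases hwp.chain hy with h3 | h3
        · exact h3
        · have h4 := (htop w).1 (hy.trans huv')
          have h5 := (h4.eq_or_of_parent hw).resolve_left hwu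
          exact absurd (h5.antisymm ((hoth p hpu hpv' u).1 h3)) hpu
      · have h3 := (hoth y hyu hyv w).1 hy
        exact (hoth y hyu hyv p).2 ((h3.eq_or_of_parent hw).resolve_left hyw)

/-- Adjacency in the rotation graph, in terms of descendant relations. -/
theorem rotationGraph_adj_iff {V : Type u} [Finite V] {G : SimpleGraph V} (hG : G.Preconnected)
    {T T' : SearchTree G} :
    (rotationGraph G).Adj T T' ↔ ∃ p c, IsFlip T.Desc T'.Desc p c := by
  rw [rotationGraph, SimpleGraph.fromRel_adj]
  constructor
  · rintro ⟨-, ⟨u, v, h⟩ | ⟨u, v, h⟩⟩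
    · exact ⟨u, v, h.isFlip⟩
    · exact ⟨v, u, h.isFlip.symm (T'.isSearchOrder hG) (T.isSearchOrder hG)⟩
  · rintro ⟨p, c, h⟩
    refine ⟨?_, Or.inl ⟨p, c, h.isRotation (T.isSearchOrder hG) (T'.isSearchOrder hG)⟩⟩
    rintro rfl
    have hA := T.isSearchOrder hG
    exact h.ne (hA.antisymm _ _ h.le ((h.top_iff p).2 (hA.refl p)))

/-- A map of search orders that preserves flips transfers colourings of rotation graphs. -/
theorem rotationGraph_colorable_of_map {V W : Type*} [Finite V] [Finite W] {G : SimpleGraph V}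
    {H : SimpleGraph W} (hG : G.Connected) (hH : H.Connected)
    (F : (V → V → Prop) → (W → W → Prop))
    (hF : ∀ A, IsSearchOrder G A → IsSearchOrder H (F A))
    (hflip : ∀ A A' p c, IsSearchOrder G A → IsSearchOrder G A' → IsFlip A A' p c →
      ∃ p' c', IsFlip (F A) (F A') p' c') {n : ℕ} (h : (rotationGraph H).Colorable n) :
    (rotationGraph G).Colorable n := by
  choose f hf using fun T : SearchTree G =>
    (hF T.Desc (T.isSearchOrder hG.preconnected)).exists_searchTree hH
  refine h.of_hom ⟨f, fun {T T'} hTT' => ?_⟩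
  obtain ⟨p, c, hpc⟩ := (rotationGraph_adj_iff hG.preconnected).1 hTT'
  obtain ⟨p', c', h'⟩ := hflip _ _ p c (T.isSearchOrder hG.preconnected)
    (T'.isSearchOrder hG.preconnected) hpc
  have e : ∀ S : SearchTree G, (f S).Desc = F S.Desc := fun S =>
    funext fun x => funext fun w => propext (hf S x w)
  exact (rotationGraph_adj_iff hH.preconnected).2 ⟨p', c', by rw [e, e]; exact h'⟩

/-! ### False twins in search orders -/

theorem addFalseTwin_connected {V : Type u} {G : SimpleGraph V} {v : V} (hG : G.Connected)
    (hv : ∃ w, G.Adj v w) : (addFalseTwin G v).Connected := by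
  obtain ⟨w, hw⟩ := hv
  rw [SimpleGraph.connected_iff_exists_forall_reachable]
  have hsome : ∀ x, (addFalseTwin G v).Reachable (some w) (some x) := fun x =>
    (hG.preconnected w x).map (⟨some, fun h => h⟩ : G →g addFalseTwin G v)
  refine ⟨some w, fun x => ?_⟩
  cases x with
  | none => exact SimpleGraph.Adj.reachable (show G.Adj w v from hw.symm)
  | some x => exact hsome x

/-- `f` and `g` are, in some order, the two twins `some v` and `none` of `addFalseTwin G v`. -/
def IsTwinPair {V : Type u} (v : V) (f g : Option V) : Prop :=
  f = some v ∧ g = none ∨ f = none ∧ g = some v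

/-- The embedding of `V` into `Option V` that sends `v` to the twin `g`. -/
def twinLift {V : Type u} [DecidableEq V] (v : V) (g : Option V) (x : V) : Option V :=
  if x = v then g else some x

/-- The relation on `V` obtained from one on `Option V` by deleting one twin of `v` and letting the
other one, `g`, play the role of `v`. -/
def twinRestrict {V : Type u} [DecidableEq V] (v : V) (g : Option V)
    (A : Option V → Option V → Prop) (x y : V) : Prop :=
  A (twinLift v g x) (twinLift v g y)

namespace IsTwinPair

variable {V : Type u} {v : V} {f g : Option V}

theorem symm (h : IsTwinPair v f g) : IsTwinPair v g f := by
  rcases h with ⟨rfl, rfl⟩ | ⟨rfl, rfl⟩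
  · exact Or.inr ⟨rfl, rfl⟩
  · exact Or.inl ⟨rfl, rfl⟩

theorem ne (h : IsTwinPair v f g) : f ≠ g := by
  rcases h with ⟨rfl, rfl⟩ | ⟨rfl, rfl⟩ <;> simp

theorem getD (h : IsTwinPair v f g) : f.getD v = v := by
  rcases h with ⟨rfl, rfl⟩ | ⟨rfl, rfl⟩ <;> rfl

theorem adj_iff (h : IsTwinPair v f g) (G : SimpleGraph V) (z : Option V) :
    (addFalseTwin G v).Adj f z ↔ (addFalseTwin G v).Adj g z := by
  change G.Adj (f.getD v) (z.getD v) ↔ G.Adj (g.getD v) (z.getD v)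
  rw [h.getD, h.symm.getD]

variable [DecidableEq V]

theorem getD_lift (h : IsTwinPair v f g) (x : V) : (twinLift v g x).getD v = x := by
  unfold twinLift
  split_ifs with hx
  · rw [h.symm.getD, hx]
  · rfl

theorem lift_getD (h : IsTwinPair v f g) {z : Option V} (hz : z ≠ f) :
    twinLift v g (z.getD v) = z := by
  unfold twinLift
  rcases h with ⟨rfl, rfl⟩ | ⟨rfl, rfl⟩
  · cases z with
    | none => simp
    | some z =>
      have : z ≠ v := fun h => hz (by rw [h])
      simp [this]
  · cases z with
    | none => exact absurd rfl hz
    | some z =>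
      by_cases h : z = v <;> simp [h]

theorem lift_ne (h : IsTwinPair v f g) (x : V) : twinLift v g x ≠ f := by
  unfold twinLift
  rcases h with ⟨rfl, rfl⟩ | ⟨rfl, rfl⟩
  · split_ifs with hx
    · simp
    · simpa using hx
  · split_ifs with hx <;> simp

theorem lift_self (v : V) (g : Option V) : twinLift v g v = g := by
  simp [twinLift]

end IsTwinPair

section Twins

variable {V : Type u} {G : SimpleGraph V} {v : V} {f g : Option V} {A : Option V → Option V → Prop}

/-- Incomparable twins are leaves: a neighbour of one twin below it would be comparable with the
other twin as well. -/
theorem IsSearchOrder.twin_leaf (hA : IsSearchOrder (addFalseTwin G v) A) (ht : IsTwinPair v f g)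
    (hfg : ¬ A f g) (hgf : ¬ A g f) {x : Option V} (hx : A x f) : x = f := by
  by_contra hne
  obtain ⟨z, hz : A z f, hadj⟩ :=
    exists_adj_of_preconnected_induce (hA.conn f) (hA.refl f) hx (Ne.symm hne)
  rcases hA.adj _ _ ((ht.adj_iff G z).1 hadj) with h1 | h1
  · exact hgf (hA.trans _ _ _ h1 hz)
  · rcases hA.chain _ _ _ hz h1 with h2 | h2
    · exact hfg h2
    · exact hgf h2

/-- Everything strictly above a twin that is not below the other one is above both twins. -/
theorem IsSearchOrder.twin_below [Finite V] (hA : IsSearchOrder (addFalseTwin G v) A)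
    (ht : IsTwinPair v f g) (hfg : ¬ A f g) {y : Option V} (hy : A f y) (hne : f ≠ y) :
    A g y := by
  by_cases hgf : A g f
  · exact hA.trans _ _ _ hgf hy
  obtain ⟨p, hp1, hp2, hp3⟩ := hA.exists_cover hy hne
  obtain ⟨x, hx, hadj⟩ := hA.exists_adj_of_cover hp1 hp2 hp3
  rw [hA.twin_leaf ht hfg hgf hx] at hadj
  have hpy := (hp3 y hy).resolve_left hne
  rcases hA.adj _ _ ((ht.adj_iff G p).1 hadj.symm) with h1 | h1
  · exact hA.trans _ _ _ h1 hpy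
  · exact absurd (hA.trans _ _ _ hp2 h1) hfg

/-- If the edges at `v` dominate `G`, then the upper of two comparable twins is comparable with
every vertex. -/
theorem IsSearchOrder.twin_comparable (hA : IsSearchOrder (addFalseTwin G v) A)
    (ht : IsTwinPair v f g) (hD : ∀ x y, G.Adj v x → y = x ∨ G.Adj v y ∨ G.Adj x y)
    (hgf : A g f) (y : Option V) : A y f ∨ A f y := by
  obtain ⟨x, hx : A x f, hadj⟩ :=
    exists_adj_of_preconnected_induce (hA.conn f) (hA.refl f) hgf ht.ne
  have hadj' : G.Adj v (x.getD v) := by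
    have : G.Adj (f.getD v) (x.getD v) := hadj
    rwa [ht.getD] at this
  have hf : G.Adj v (y.getD v) → A y f ∨ A f y := fun h =>
    (hA.adj f y (show G.Adj (f.getD v) (y.getD v) by rwa [ht.getD])).symm
  rcases hD _ (y.getD v) hadj' with h1 | h1 | h1
  · exact hf (by rwa [h1])
  · exact hf h1
  · rcases hA.adj x y h1 with h2 | h2
    · exact hA.chain _ _ _ h2 hx
    · exact Or.inl (hA.trans _ _ _ h2 hx)

/-- The upper of two comparable twins has exactly one child: each of its children's subtrees
contains a neighbour of the twins, hence the lower twin. -/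
theorem IsSearchOrder.twin_child [Finite V] (hA : IsSearchOrder (addFalseTwin G v) A)
    (ht : IsTwinPair v f g) (hgf : A g f) {w : Option V} (hwf : w ≠ f) (hle : A w f)
    (hcov : ∀ y, A w y → w = y ∨ A f y) {z : Option V} (hz : A z f) (hzf : z ≠ f) : A z w := by
  -- the lower twin is below every child of `f`
  have key : ∀ w, w ≠ f → A w f → (∀ y, A w y → w = y ∨ A f y) → A g w := by
    intro w hwf hle hcov
    obtain ⟨x, hx, hadj⟩ := hA.exists_adj_of_cover hwf hle hcov
    rcases hA.adj _ _ ((ht.adj_iff G x).1 hadj) with h1 | h1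
    · exact hA.trans _ _ _ h1 hx
    · rcases hA.chain _ _ _ h1 hx with h2 | h2
      · exact h2
      · rcases hcov g h2 with h3 | h3
        · rw [← h3]; exact hA.refl w
        · exact absurd (hA.antisymm _ _ h3 hgf) ht.ne
  obtain ⟨c, hzc, hcf, hcf', hc⟩ := hA.exists_cocover hz hzf
  have hcw : c = w := by
    rcases hA.chain _ _ _ (key c hcf hcf' hc) (key w hwf hle hcov) with h1 | h1
    · rcases hc w h1 with h2 | h2
      · exact h2
      · exact absurd (hA.antisymm _ _ hle h2) hwf
    · rcases hcov c h1 with h2 | h2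
      · exact h2.symm
      · exact absurd (hA.antisymm _ _ hcf' h2) hcf
  rwa [← hcw]

/-! ### Deleting the upper twin -/

variable [DecidableEq V]

/-- Deleting a twin that is not below the other one yields a search order of `G`; its down-sets
are connected as images of the old ones under the projection that identifies the twins. -/
theorem IsSearchOrder.twinRestrict [Finite V] (hA : IsSearchOrder (addFalseTwin G v) A)
    (ht : IsTwinPair v f g) (hfg : ¬ A f g) : IsSearchOrder G (twinRestrict v g A) where
  refl _ := hA.refl _
  antisymm x y h h' := by
    have := hA.antisymm _ _ h h'
    rw [← ht.getD_lift x, this, ht.getD_lift]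
  trans _ _ _ h h' := hA.trans _ _ _ h h'
  chain _ _ _ h h' := hA.chain _ _ _ h h'
  adj x y h := by
    refine hA.adj _ _ ?_
    change G.Adj ((twinLift v g x).getD v) ((twinLift v g y).getD v)
    rwa [ht.getD_lift, ht.getD_lift]
  conn w := by
    rw [preconnected_induce_iff]
    rintro K ⟨x, hx, hxK⟩ hcl y hy
    have hmem : ∀ a, A a (twinLift v g w) → A (twinLift v g (a.getD v)) (twinLift v g w) := by
      intro a ha
      by_cases haf : a = f
      · rw [haf, ht.getD, IsTwinPair.lift_self]
        rw [haf] at ha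
        exact hA.twin_below ht hfg ha (ht.lift_ne w).symm
      · rwa [ht.lift_getD haf]
    have := preconnected_induce_iff.1 (hA.conn (twinLift v g w)) {a | a.getD v ∈ K}
      ⟨twinLift v g x, hx, by simpa only [Set.mem_ofPred_eq, ht.getD_lift] using hxK⟩
      (fun a ha haK b hb hab => hcl _ (hmem a ha) haK _ (hmem b hb) hab) (twinLift v g y) hy
    simpa only [Set.mem_ofPred_eq, ht.getD_lift] using this

theorem IsFlip.twinRestrict {A' : Option V → Option V → Prop} {p c : Option V}
    (h : IsFlip A A' p c) (ht : IsTwinPair v f g) (hp : p ≠ f) (hc : c ≠ f) :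
    IsFlip (twinRestrict v g A) (twinRestrict v g A') (p.getD v) (c.getD v) := by
  have hp' := ht.lift_getD hp
  have hc' := ht.lift_getD hc
  refine ⟨fun he => h.ne ?_, ?_, fun y hy => ?_, fun x => ?_, fun w hwp hwc x => ?_⟩
  · rw [← hp', ← hc', he]
  · unfold _root_.twinRestrict
    rw [hp', hc']
    exact h.le
  · unfold _root_.twinRestrict at hy ⊢
    rw [hc'] at hy
    rw [hp']
    refine (h.cover _ hy).imp_left fun he => ?_
    rw [he, ht.getD_lift]
  · unfold _root_.twinRestrict
    rw [hp', hc']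
    exact h.top_iff _
  · refine h.other _ (fun he => hwp ?_) (fun he => hwc ?_) _
    · rw [← he, ht.getD_lift]
    · rw [← he, ht.getD_lift]

/-- Rotating a twin `f` over a vertex `p` so that it ends up above the other twin does not change
the order on the remaining vertices. -/
theorem IsFlip.twinRestrict_eq [Finite V] {A' : Option V → Option V → Prop} {p : Option V}
    (h : IsFlip A A' p f) (hA : IsSearchOrder (addFalseTwin G v) A)
    (hA' : IsSearchOrder (addFalseTwin G v) A') (ht : IsTwinPair v f g) (hgf : A' g f) :
    _root_.twinRestrict v g A = _root_.twinRestrict v g A' := by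
  have hs := h.symm hA hA'
  funext x y
  refine propext ?_
  change A (twinLift v g x) (twinLift v g y) ↔ A' (twinLift v g x) (twinLift v g y)
  by_cases hy : twinLift v g y = p
  · rw [hy, ← h.top_iff]
    exact ⟨fun hx => hA'.twin_child ht hgf hs.ne hs.le hs.cover hx (ht.lift_ne x),
      fun hx => hA'.trans _ _ _ hx hs.le⟩
  · exact (h.other _ hy (ht.lift_ne y) _).symm

theorem twinRestrict_congr (hA : IsSearchOrder (addFalseTwin G v) A)
    (h1 : ∀ y, f ≠ y → g ≠ y → (A f y ↔ A g y)) (h2 : ∀ y, y ≠ f → y ≠ g → (A y f ↔ A y g))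
    (ht : IsTwinPair v f g) : twinRestrict v f A = twinRestrict v g A := by
  funext x y
  refine propext ?_
  have hne : ∀ z, z ≠ v → some z ≠ f ∧ some z ≠ g := by
    intro z hz
    rcases ht with ⟨rfl, rfl⟩ | ⟨rfl, rfl⟩ <;> simpa using hz
  unfold twinRestrict twinLift
  split_ifs with hx hy hy
  · exact ⟨fun _ => hA.refl _, fun _ => hA.refl _⟩
  · exact h1 _ (hne y hy).1.symm (hne y hy).2.symm
  · exact h2 _ (hne x hx).1 (hne x hx).2
  · rfl

theorem twinRestrict_eq_of_incomparable [Finite V] (hA : IsSearchOrder (addFalseTwin G v) A)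
    (ht : IsTwinPair v f g) (hfg : ¬ A f g) (hgf : ¬ A g f) :
    twinRestrict v f A = twinRestrict v g A := by
  refine twinRestrict_congr hA (fun y hf hg => ?_) (fun y hf hg => ?_) ht
  · exact ⟨fun h => hA.twin_below ht hfg h hf, fun h => hA.twin_below ht.symm hgf h hg⟩
  · exact ⟨fun h => absurd (hA.twin_leaf ht hfg hgf h) hf,
      fun h => absurd (hA.twin_leaf ht.symm hgf hfg h) hg⟩

end Twins

/-! ### Colouring the rotation graph after adding a false twin -/

section TwinColor

open Classical in
/-- The search order of `G` obtained from one of `addFalseTwin G v` by deleting the upper twin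
(either of them, if they are incomparable). -/
noncomputable def deleteTwin {V : Type u} (v : V) (A : Option V → Option V → Prop) :
    V → V → Prop :=
  if A none (some v) then twinRestrict v none A else twinRestrict v (some v) A

/-- A number that tells the two twins apart modulo two. -/
def twinKind {V : Type u} : Option V → ℕ
  | none => 1
  | some _ => 0

/-- The colour `0` or `1` given by the parity of `k`. -/
def parityColor (m k : ℕ) : Fin (m + 3) := if Even k then 0 else 1

open Classical in
/-- The part of the colour that records the twins: `2` if they are incomparable, otherwise the
parity of the number of descendants of the upper twin, shifted by which twin it is. -/
noncomputable def twinColor {V : Type u} (m : ℕ) (v : V) (A : Option V → Option V → Prop) :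
    Fin (m + 3) :=
  if A none (some v) then parityColor m ({x | A x (some v)}.ncard + twinKind (some v))
  else if A (some v) none then parityColor m ({x | A x none}.ncard + twinKind (none : Option V))
  else 2

theorem parityColor_succ_ne (m k : ℕ) : parityColor m k ≠ parityColor m (k + 1) := by
  unfold parityColor
  by_cases h : Even k
  · have : ¬ Even (k + 1) := by simpa [Nat.even_add_one] using h
    rw [if_pos h, if_neg this]
    simp
  · have : Even (k + 1) := by simpa [Nat.even_add_one] using h
    rw [if_neg h, if_pos this]
    simp

theorem parityColor_ne_two (m k : ℕ) : parityColor m k ≠ 2 := by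
  unfold parityColor
  have h2 : 2 % (m + 3) = 2 := Nat.mod_eq_of_lt (by omega)
  split_ifs <;> simp [Fin.ext_iff, h2]

variable {V : Type u} {G : SimpleGraph V} {v : V} {f g : Option V} {A A' : Option V → Option V → Prop}

theorem deleteTwin_of_le [DecidableEq V] (hA : IsSearchOrder (addFalseTwin G v) A)
    (ht : IsTwinPair v f g) (hgf : A g f) : deleteTwin v A = twinRestrict v g A := by
  have hfg : ¬ A f g := fun h => ht.ne (hA.antisymm _ _ h hgf)
  unfold deleteTwin
  rcases ht with ⟨rfl, rfl⟩ | ⟨rfl, rfl⟩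
  · rw [if_pos hgf]
    congr!
  · rw [if_neg hfg]
    congr!

theorem twinColor_of_le (m : ℕ) (hA : IsSearchOrder (addFalseTwin G v) A)
    (ht : IsTwinPair v f g) (hgf : A g f) :
    twinColor m v A = parityColor m ({x | A x f}.ncard + twinKind f) := by
  have hfg : ¬ A f g := fun h => ht.ne (hA.antisymm _ _ h hgf)
  unfold twinColor
  rcases ht with ⟨rfl, rfl⟩ | ⟨rfl, rfl⟩
  · rw [if_pos hgf]
  · rw [if_neg hfg, if_pos hgf]

theorem deleteTwin_of_incomparable [Finite V] [DecidableEq V]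
    (hA : IsSearchOrder (addFalseTwin G v) A)
    (ht : IsTwinPair v f g) (hfg : ¬ A f g) (hgf : ¬ A g f) :
    deleteTwin v A = twinRestrict v g A := by
  have key := twinRestrict_eq_of_incomparable hA ht hfg hgf
  unfold deleteTwin
  rcases ht with ⟨rfl, rfl⟩ | ⟨rfl, rfl⟩
  · rw [if_neg hgf, ← key]
    congr!
  · rw [if_neg hfg]
    congr!

theorem twinColor_of_incomparable (m : ℕ) (ht : IsTwinPair v f g) (hfg : ¬ A f g)
    (hgf : ¬ A g f) : twinColor m v A = 2 := by
  unfold twinColor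
  rcases ht with ⟨rfl, rfl⟩ | ⟨rfl, rfl⟩
  · rw [if_neg hgf, if_neg hfg]
  · rw [if_neg hfg, if_neg hgf]

theorem IsSearchOrder.deleteTwin [Finite V] (hA : IsSearchOrder (addFalseTwin G v) A) :
    IsSearchOrder G (deleteTwin v A) := by
  classical
  have ht : IsTwinPair v (some v) none := Or.inl ⟨rfl, rfl⟩
  by_cases h1 : A none (some v)
  · rw [deleteTwin_of_le hA ht h1]
    exact hA.twinRestrict ht fun h => ht.ne (hA.antisymm _ _ h h1)
  · have hr := hA.twinRestrict ht.symm h1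
    by_cases h2 : A (some v) none
    · rwa [deleteTwin_of_le hA ht.symm h2]
    · rwa [deleteTwin_of_incomparable hA ht.symm h1 h2]

/-- Exactly one of the two parts of the colour of a search order changes. -/
def ChangesOnePart (m : ℕ) (v : V) (A A' : Option V → Option V → Prop) : Prop :=
  deleteTwin v A = deleteTwin v A' ∧ twinColor m v A ≠ twinColor m v A' ∨
    (∃ p c, IsFlip (deleteTwin v A) (deleteTwin v A') p c) ∧ twinColor m v A = twinColor m v A'

theorem ChangesOnePart.symm [Finite V] {m : ℕ} (h : ChangesOnePart m v A A')
    (hA : IsSearchOrder (addFalseTwin G v) A) (hA' : IsSearchOrder (addFalseTwin G v) A') :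
    ChangesOnePart m v A' A := by
  rcases h with ⟨h1, h2⟩ | ⟨⟨p, c, h1⟩, h2⟩
  · exact Or.inl ⟨h1.symm, h2.symm⟩
  · exact Or.inr ⟨⟨c, p, h1.symm hA.deleteTwin hA'.deleteTwin⟩, h2.symm⟩

/-- A flip that does not involve the twin `f`, where `f` is above the other twin. -/
theorem IsFlip.changesOnePart_of_le [Finite V] (m : ℕ) {p c : Option V} (h : IsFlip A A' p c)
    (hA : IsSearchOrder (addFalseTwin G v) A) (hA' : IsSearchOrder (addFalseTwin G v) A')
    (ht : IsTwinPair v f g) (hp : p ≠ f) (hc : c ≠ f) (hgf : A g f) :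
    ChangesOnePart m v A A' := by
  classical
  have hgf' : A' g f := (h.other f hp.symm hc.symm g).2 hgf
  refine Or.inr ⟨⟨p.getD v, c.getD v, ?_⟩, ?_⟩
  · rw [deleteTwin_of_le hA ht hgf, deleteTwin_of_le hA' ht hgf']
    exact h.twinRestrict ht hp hc
  · rw [twinColor_of_le m hA ht hgf, twinColor_of_le m hA' ht hgf']
    simp only [h.other f hp.symm hc.symm]

/-- A flip that rotates a twin `f` over a vertex that is not the other twin. -/
theorem IsFlip.changesOnePart_of_twin [Finite V] (m : ℕ) {p : Option V} (h : IsFlip A A' p f)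
    (hA : IsSearchOrder (addFalseTwin G v) A) (hA' : IsSearchOrder (addFalseTwin G v) A')
    (ht : IsTwinPair v f g) (hD : ∀ x y, G.Adj v x → y = x ∨ G.Adj v y ∨ G.Adj x y)
    (hp : p ≠ g) : ChangesOnePart m v A A' := by
  classical
  by_cases hfg : A f g
  · exact h.changesOnePart_of_le m hA hA' ht.symm hp ht.ne hfg
  have hgf' : A' g f := (h.top_iff g).2 (hA.twin_below ht hfg h.le h.ne)
  have heq := h.twinRestrict_eq hA hA' ht hgf'
  left
  rw [deleteTwin_of_le hA' ht hgf', twinColor_of_le m hA' ht hgf', ← heq]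
  by_cases hgf : A g f
  · refine ⟨deleteTwin_of_le hA ht hgf, ?_⟩
    rw [twinColor_of_le m hA ht hgf]
    -- as `f` is comparable with everything, `p` is the only vertex it gains as a descendant
    have hset : {x | A' x f} = insert p {x | A x f} := by
      ext x
      simp only [Set.mem_ofPred_eq, Set.mem_insert_iff, h.top_iff]
      constructor
      · intro hx
        rcases hA.twin_comparable ht hD hgf x with h1 | h1
        · exact Or.inr h1
        · rcases h.cover x h1 with h2 | h2
          · rw [h2]; exact Or.inr (hA.refl x)
          · exact Or.inl (hA.antisymm _ _ hx h2)
      · rintro (rfl | hx)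
        · exact hA.refl x
        · exact hA.trans _ _ _ hx h.le
    have hnot : p ∉ {x | A x f} := fun hx => h.ne (hA.antisymm _ _ h.le hx)
    rw [hset, Set.ncard_insert_of_notMem hnot (Set.toFinite _), Nat.add_right_comm]
    exact parityColor_succ_ne _ _
  · refine ⟨deleteTwin_of_incomparable hA ht hfg hgf, ?_⟩
    rw [twinColor_of_incomparable m ht hfg hgf]
    exact (parityColor_ne_two _ _).symm

/-- A flip that exchanges the two twins. -/
theorem IsFlip.changesOnePart_of_twins [Finite V] (m : ℕ) (h : IsFlip A A' f g)
    (hA : IsSearchOrder (addFalseTwin G v) A) (hA' : IsSearchOrder (addFalseTwin G v) A')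
    (ht : IsTwinPair v f g) : ChangesOnePart m v A A' := by
  classical
  have hgf := h.le
  have hfg' : A' f g := (h.top_iff f).2 (hA.refl f)
  left
  constructor
  · -- in `A` it does not matter which twin is deleted, as `g` is the only child of `f`
    rw [deleteTwin_of_le hA ht hgf, deleteTwin_of_le hA' ht.symm hfg',
      ← h.twinRestrict_eq hA hA' ht.symm hfg']
    refine twinRestrict_congr hA (fun y hg hf => ?_) (fun y hg hf => ?_) ht.symm
    · exact ⟨fun hy => (h.cover y hy).resolve_left hg, fun hy => hA.trans _ _ _ hgf hy⟩
    · exact ⟨fun hy => hA.trans _ _ _ hy hgf,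
        fun hy => hA.twin_child ht hgf h.ne hgf h.cover hy hf⟩
  · rw [twinColor_of_le m hA ht hgf, twinColor_of_le m hA' ht.symm hfg']
    simp only [h.top_iff]
    rcases ht with ⟨rfl, rfl⟩ | ⟨rfl, rfl⟩
    · exact parityColor_succ_ne _ _
    · exact (parityColor_succ_ne _ _).symm

/-- Every flip changes exactly one of the two parts of the colour. -/
theorem IsFlip.changesOnePart [Finite V] (m : ℕ) {p c : Option V} (h : IsFlip A A' p c)
    (hA : IsSearchOrder (addFalseTwin G v) A) (hA' : IsSearchOrder (addFalseTwin G v) A')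
    (hD : ∀ x y, G.Adj v x → y = x ∨ G.Adj v y ∨ G.Adj x y) : ChangesOnePart m v A A' := by
  classical
  have ht : IsTwinPair v (some v) none := Or.inl ⟨rfl, rfl⟩
  have hup : ∀ {A A' : Option V → Option V → Prop} {f g p : Option V},
      IsSearchOrder (addFalseTwin G v) A → IsSearchOrder (addFalseTwin G v) A' →
      IsTwinPair v f g → IsFlip A A' p f → ChangesOnePart m v A A' := by
    intro A A' f g p hA hA' ht h
    by_cases hp : p = g
    · rw [hp] at h
      exact h.changesOnePart_of_twins m hA hA' ht.symm
    · exact h.changesOnePart_of_twin m hA hA' ht hD hp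
  by_cases h1 : c = some v
  · exact hup hA hA' ht (h1 ▸ h)
  by_cases h2 : c = none
  · exact hup hA hA' ht.symm (h2 ▸ h)
  by_cases h3 : p = some v
  · exact (hup hA' hA ht (h3 ▸ h.symm hA hA')).symm hA' hA
  by_cases h4 : p = none
  · exact (hup hA' hA ht.symm (h4 ▸ h.symm hA hA')).symm hA' hA
  by_cases h5 : A none (some v)
  · exact h.changesOnePart_of_le m hA hA' ht h3 h1 h5
  by_cases h6 : A (some v) none
  · exact h.changesOnePart_of_le m hA hA' ht.symm h4 h2 h6
  have h5' : ¬ A' none (some v) := fun h' => h5 ((h.other _ (Ne.symm h3) (Ne.symm h1) _).1 h')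
  have h6' : ¬ A' (some v) none := fun h' => h6 ((h.other _ (Ne.symm h4) (Ne.symm h2) _).1 h')
  refine Or.inr ⟨⟨p.getD v, c.getD v, ?_⟩, ?_⟩
  · rw [deleteTwin_of_incomparable hA ht h6 h5, deleteTwin_of_incomparable hA' ht h6' h5']
    exact h.twinRestrict ht h3 h1
  · rw [twinColor_of_incomparable m ht h6 h5, twinColor_of_incomparable m ht h6' h5']

end TwinColor

/-- Adding a false twin of a vertex all of whose edges are dominating preserves colourability of
the rotation graph with at least three colours. -/
theorem rotationGraph_addFalseTwin_colorable {V : Type u} [Finite V] {G : SimpleGraph V} {v : V}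
    (hG : G.Connected) (hv : ∃ w, G.Adj v w)
    (hD : ∀ x y, G.Adj v x → y = x ∨ G.Adj v y ∨ G.Adj x y) {n : ℕ} (hn : 3 ≤ n)
    (h : (rotationGraph G).Colorable n) : (rotationGraph (addFalseTwin G v)).Colorable n := by
  obtain ⟨m, rfl⟩ := Nat.exists_eq_add_of_le' hn
  obtain ⟨col⟩ := h
  have hH := addFalseTwin_connected hG hv
  have hord := fun T : SearchTree (addFalseTwin G v) => T.isSearchOrder hH.preconnected
  choose F hF using fun T : SearchTree (addFalseTwin G v) =>
    (hord T).deleteTwin.exists_searchTree hG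
  have hF' : ∀ T, (F T).Desc = deleteTwin v T.Desc := fun T =>
    funext fun x => funext fun w => propext (hF T x w)
  refine ⟨SimpleGraph.Coloring.mk (fun T => col (F T) + twinColor m v T.Desc) ?_⟩
  intro T T' hTT' heq
  obtain ⟨p, c, hpc⟩ := (rotationGraph_adj_iff hH.preconnected).1 hTT'
  rcases hpc.changesOnePart m (hord T) (hord T') hD with ⟨h1, h2⟩ | ⟨⟨p', c', h1⟩, h2⟩
  · have : F T = F T' := SearchTree.ext_of_desc fun x w => by rw [hF', hF', h1]
    rw [this] at heq
    exact h2 (add_left_cancel heq)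
  · rw [h2] at heq
    refine col.valid ?_ (add_right_cancel heq)
    exact (rotationGraph_adj_iff hG.preconnected).2 ⟨p', c', by rw [hF', hF']; exact h1⟩

/-! ### A five-cycle in the rotation graph -/

/-- The relation on `V` in which `s` is below `t` if they are equal or `s` has smaller rank. -/
def rankOrder {V : Type u} (r : V → ℕ) (s t : V) : Prop := s = t ∨ r s < r t

/-- A rank function whose only ties are non-adjacent vertices of rank `0` gives a search order, if
every vertex of positive rank is above `y`, and `y` is reached from everywhere by going
downwards. -/
theorem isSearchOrder_rankOrder {V : Type u} {G : SimpleGraph V} {r : V → ℕ} (y : V) (d : V → ℕ)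
    (htie : ∀ s t, r s = r t → s ≠ t → r s = 0 ∧ ¬ G.Adj s t)
    (hy : ∀ w, r w = 0 ∨ rankOrder r y w)
    (hd : ∀ t, t ≠ y → ∃ u, G.Adj t u ∧ d u < d t ∧ (u = y ∨ r u < r t)) :
    IsSearchOrder G (rankOrder r) where
  refl _ := Or.inl rfl
  antisymm x z h h' := by
    rcases h with h | h
    · exact h
    rcases h' with h' | h'
    · exact h'.symm
    · omega
  trans x z w h h' := by
    rcases h with rfl | h
    · exact h'
    rcases h' with rfl | h'
    · exact Or.inr h
    · exact Or.inr (h.trans h')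
  chain x z w h h' := by
    rcases h with rfl | h
    · exact Or.inl h'
    rcases h' with rfl | h'
    · exact Or.inr (Or.inr h)
    by_cases hzw : z = w
    · exact Or.inl (Or.inl hzw)
    rcases lt_trichotomy (r z) (r w) with h1 | h1 | h1
    · exact Or.inl (Or.inr h1)
    · have := (htie z w h1 hzw).1
      omega
    · exact Or.inr (Or.inr h1)
  adj x z h := by
    rcases lt_trichotomy (r x) (r z) with h1 | h1 | h1
    · exact Or.inl (Or.inr h1)
    · exact absurd h (htie x z h1 h.ne).2
    · exact Or.inr (Or.inr h1)
  conn w := by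
    rcases hy w with hw | hw
    · have hsub : ∀ x, rankOrder r x w → x = w := by
        rintro x (hx | hx)
        · exact hx
        · omega
      rw [preconnected_induce_iff]
      rintro K ⟨x, hx, hxK⟩ - z hz
      rwa [hsub z hz, ← hsub x hx]
    · rintro a b
      have key : ∀ n, ∀ t (ht : rankOrder r t w), d t = n →
          (G.induce {x | rankOrder r x w}).Reachable ⟨t, ht⟩ ⟨y, hw⟩ := by
        intro n
        induction n using Nat.strong_induction_on with
        | _ n ih =>
          intro t ht htn
          by_cases hty : t = y
          · subst hty
            exact SimpleGraph.Reachable.refl _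
          · obtain ⟨u, hadj, hdu, hu⟩ := hd t hty
            have huw : rankOrder r u w := by
              rcases hu with rfl | hu
              · exact hw
              · rcases ht with rfl | ht
                · exact Or.inr hu
                · exact Or.inr (hu.trans ht)
            exact (SimpleGraph.Adj.reachable (show (G.induce {x | rankOrder r x w}).Adj
              ⟨t, ht⟩ ⟨u, huw⟩ from hadj)).trans (ih (d u) (by omega) u huw rfl)
      exact (key _ a.1 a.2 rfl).trans (key _ b.1 b.2 rfl).symm

/-- In a connected graph, vertices can be ranked injectively so that every vertex other than `y` has
a neighbour that is closer to `y` and has smaller rank. -/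
theorem exists_rank {V : Type u} [Finite V] {G : SimpleGraph V} (hG : G.Connected) (y : V) :
    ∃ ρ : V → ℕ, Function.Injective ρ ∧
      ∀ t, t ≠ y → ∃ u, G.Adj t u ∧ G.dist u y < G.dist t y ∧ ρ u < ρ t := by
  obtain ⟨n, ⟨e⟩⟩ := Finite.exists_equiv_fin V
  have hlt : ∀ s, (e s : ℕ) < n := fun s => (e s).2
  -- rank by the distance to `y`, with ties broken by an enumeration of the vertices
  refine ⟨fun s => G.dist s y * n + e s, fun s t hst => ?_, fun t hty => ?_⟩
  · have h1 := congrArg (· % n) hst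
    simp only [Nat.mul_add_mod_self_right, Nat.mod_eq_of_lt (hlt _)] at h1
    exact e.injective (Fin.ext h1)
  · obtain ⟨p, hp⟩ := hG.exists_walk_length_eq_dist t y
    cases p with
    | nil => exact absurd rfl hty
    | @cons _ u _ hadj q =>
      have h1 : G.dist u y < G.dist t y := by
        rw [← hp, SimpleGraph.Walk.length_cons]
        exact Nat.lt_succ_of_le (SimpleGraph.dist_le q)
      refine ⟨u, hadj, h1, ?_⟩
      have h2 := Nat.mul_le_mul_right n h1
      have h3 := hlt u
      rw [Nat.succ_mul] at h2
      change G.dist u y * n + e u < G.dist t y * n + e t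
      omega

open Classical in
/-- The rank function that gives `x`, `y`, `z` the ranks `i`, `j`, `k` and, if these
are at most `2`, puts all other vertices above them, in the order of `ρ`. -/
noncomputable def pathRank {V : Type u} (ρ : V → ℕ) (x y z : V) (i j k : ℕ) (s : V) : ℕ :=
  if s = x then i else if s = y then j else if s = z then k else ρ s + 3

/-- A connected graph that is not complete contains an induced path `x - y - z`. Putting all other
vertices above it in a fixed order, the five search trees on the path give a five-cycle, so two
colours do not suffice. -/
theorem not_colorable_two_rotationGraph {V : Type u} [Finite V] {G : SimpleGraph V}
    (hG : G.Connected) (hne : G ≠ ⊤) : ¬ (rotationGraph G).Colorable 2 := by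
  rintro ⟨col⟩
  obtain ⟨a, b, hab, hnadj⟩ := SimpleGraph.ne_top_iff_exists_not_adj.1 hne
  obtain ⟨w, hw⟩ := hG.exists_walk_length_eq_dist a b
  obtain ⟨x, y, z, hxy, hyz, hxz, hxz'⟩ :=
    SimpleGraph.Walk.exists_adj_adj_not_adj_ne hw (hG.one_lt_dist_of_ne_of_not_adj hab hnadj)
  obtain ⟨ρ, hinj, hρ⟩ := exists_rank hG y
  have hzx : ¬ G.Adj z x := fun h => hxz h.symm
  have hxy' := hxy.ne
  have hyz' := hyz.ne
  have hord : ∀ i j k : ℕ, i ≤ 2 → j ≤ 2 → k ≤ 2 → i ≠ j → k ≠ j → (i = k → i = 0) →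
      (i = 0 ∨ j < i) → (k = 0 ∨ j < k) →
      ∃ T : SearchTree G, T.Desc = rankOrder (pathRank ρ x y z i j k) := by
    intro i j k hi hj hk hij hkj hik h1 h2
    have hA : IsSearchOrder G (rankOrder (pathRank ρ x y z i j k)) := by
      refine isSearchOrder_rankOrder y (fun t => G.dist t y) ?_ ?_ ?_
      · intro s t hst hne
        have := hinj.ne hne
        unfold pathRank at hst ⊢
        grind
      · intro w
        unfold rankOrder pathRank
        grind
      · intro t hty
        by_cases htx : t = x
        · refine ⟨y, htx ▸ hxy, ?_, Or.inl rfl⟩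
          simpa using hG.pos_dist_of_ne hty
        by_cases htz : t = z
        · refine ⟨y, htz ▸ hyz.symm, ?_, Or.inl rfl⟩
          simpa using hG.pos_dist_of_ne hty
        obtain ⟨u, hu1, hu2, hu3⟩ := hρ t hty
        refine ⟨u, hu1, hu2, ?_⟩
        unfold pathRank
        grind
    obtain ⟨T, hT⟩ := hA.exists_searchTree hG
    exact ⟨T, funext fun s => funext fun t => propext (hT s t)⟩
  -- the five search trees on the path; in the second one, `x` and `z` are children of `y`
  obtain ⟨T₁, h₁⟩ := hord 2 1 0 (by omega) (by omega) (by omega) (by omega) (by omega) (by omega)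
    (by omega) (by omega)
  obtain ⟨T₂, h₂⟩ := hord 0 1 0 (by omega) (by omega) (by omega) (by omega) (by omega) (by omega)
    (by omega) (by omega)
  obtain ⟨T₃, h₃⟩ := hord 0 1 2 (by omega) (by omega) (by omega) (by omega) (by omega) (by omega)
    (by omega) (by omega)
  obtain ⟨T₄, h₄⟩ := hord 1 0 2 (by omega) (by omega) (by omega) (by omega) (by omega) (by omega)
    (by omega) (by omega)
  obtain ⟨T₅, h₅⟩ := hord 2 0 1 (by omega) (by omega) (by omega) (by omega) (by omega) (by omega)
    (by omega) (by omega)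
  have e₁ : (rotationGraph G).Adj T₁ T₂ :=
    (rotationGraph_adj_iff hG.preconnected).2 ⟨x, y, by
      rw [h₁, h₂]
      refine ⟨hxy'.symm, ?_, ?_, ?_, ?_⟩ <;> simp only [rankOrder, pathRank] <;> grind⟩
  have e₂ : (rotationGraph G).Adj T₂ T₃ :=
    (rotationGraph_adj_iff hG.preconnected).2 ⟨y, z, by
      rw [h₂, h₃]
      refine ⟨hyz'.symm, ?_, ?_, ?_, ?_⟩ <;> simp only [rankOrder, pathRank] <;> grind⟩
  have e₃ : (rotationGraph G).Adj T₃ T₄ :=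
    (rotationGraph_adj_iff hG.preconnected).2 ⟨y, x, by
      rw [h₃, h₄]
      refine ⟨hxy', ?_, ?_, ?_, ?_⟩ <;> simp only [rankOrder, pathRank] <;> grind⟩
  have e₄ : (rotationGraph G).Adj T₄ T₅ :=
    (rotationGraph_adj_iff hG.preconnected).2 ⟨z, x, by
      rw [h₄, h₅]
      refine ⟨hxz', ?_, ?_, ?_, ?_⟩ <;> simp only [rankOrder, pathRank] <;> grind⟩
  have e₅ : (rotationGraph G).Adj T₅ T₁ :=
    (rotationGraph_adj_iff hG.preconnected).2 ⟨z, y, by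
      rw [h₅, h₁]
      refine ⟨hyz', ?_, ?_, ?_, ?_⟩ <;> simp only [rankOrder, pathRank] <;> grind⟩
  have c₁ := col.valid e₁
  have c₂ := col.valid e₂
  have c₃ := col.valid e₃
  have c₄ := col.valid e₄
  have c₅ := col.valid e₅
  omega

/-! ### Comparing rotation graphs of different graphs -/

/-- The search trees in which the new twin is the root reproduce the rotation graph of `G`. -/
theorem rotationGraph_colorable_of_addFalseTwin {V : Type u} [Finite V] {G : SimpleGraph V} {v : V}
    (hG : G.Connected) (hv : ∃ w, G.Adj v w) {n : ℕ}
    (h : (rotationGraph (addFalseTwin G v)).Colorable n) : (rotationGraph G).Colorable n := by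
  have hH := addFalseTwin_connected hG hv
  refine rotationGraph_colorable_of_map hG hH
    (fun A s t => t = none ∨ ∃ a b, s = some a ∧ t = some b ∧ A a b) ?_ ?_ h
  · intro A hA
    refine ⟨?_, ?_, ?_, ?_, ?_, ?_⟩
    · rintro (_ | x)
      · exact Or.inl rfl
      · exact Or.inr ⟨x, x, rfl, rfl, hA.refl x⟩
    · rintro (_ | x) (_ | y) <;> simp
      exact hA.antisymm x y
    · rintro (_ | x) (_ | y) (_ | z) <;> simp
      exact hA.trans x y z
    · rintro (_ | x) (_ | y) (_ | z) <;> simp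
      exact hA.chain x y z
    · rintro (_ | x) (_ | y) hxy <;> simp
      exact hA.adj x y hxy
    · rintro (_ | w)
      · have hs : {x | (none : Option V) = none ∨
            ∃ a b, x = some a ∧ none = some b ∧ A a b} = Set.univ :=
          Set.eq_univ_of_forall fun _ => Or.inl rfl
        rw [hs]
        exact preconnected_induce_univ_iff.2 hH.preconnected
      · rw [preconnected_induce_iff]
        rintro K ⟨x, hx, hxK⟩ hcl y hy
        simp only [Set.mem_ofPred_eq, reduceCtorEq, Option.some.injEq, false_or] at hx hy hcl
        obtain ⟨x, _, rfl, rfl, hxw⟩ := hx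
        obtain ⟨y, _, rfl, rfl, hyw⟩ := hy
        exact preconnected_induce_iff.1 (hA.conn _) {a | some a ∈ K} ⟨x, hxw, hxK⟩
          (fun a ha haK b hb hab => hcl (some a) ⟨a, _, rfl, rfl, ha⟩ haK (some b)
            ⟨b, _, rfl, rfl, hb⟩ hab) y hyw
  · rintro A A' p c - - hf
    refine ⟨some p, some c, by simpa using hf.ne, by simpa using hf.le, ?_, ?_, ?_⟩
    · rintro (_ | y) <;> simp
      exact hf.cover y
    · rintro (_ | x) <;> simp
      exact hf.top_iff x
    · rintro (_ | w) hwp hwc (_ | x) <;> simp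
      exact hf.other w (by simpa using hwp) (by simpa using hwc) x

theorem rotationGraph_colorable_of_iso {V W : Type*} [Finite V] [Finite W] {G : SimpleGraph V}
    {H : SimpleGraph W} (e : G ≃g H) (hG : G.Connected) {n : ℕ}
    (h : (rotationGraph H).Colorable n) : (rotationGraph G).Colorable n := by
  refine rotationGraph_colorable_of_map hG (e.connected_iff.1 hG)
    (fun A s t => A (e.symm s) (e.symm t)) ?_ ?_ h
  · intro A hA
    refine ⟨fun _ => hA.refl _, fun _ _ h1 h2 => e.symm.injective (hA.antisymm _ _ h1 h2),
      fun _ _ _ => hA.trans _ _ _, fun _ _ _ => hA.chain _ _ _,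
      fun _ _ h => hA.adj _ _ (e.symm.map_adj_iff.2 h), fun w => ?_⟩
    rw [preconnected_induce_iff]
    rintro K ⟨x, hx, hxK⟩ hcl y hy
    have := preconnected_induce_iff.1 (hA.conn (e.symm w)) {a | e a ∈ K}
      ⟨e.symm x, hx, by simpa using hxK⟩ (fun a ha haK b hb hab => hcl _ (by simpa using ha) haK _
        (by simpa using hb) (e.map_adj_iff.2 hab)) (e.symm y) hy
    simpa using this
  · rintro A A' p c - - hf
    refine ⟨e p, e c, by simpa using hf.ne, by simpa using hf.le, fun y hy => ?_, fun x => ?_,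
      fun w hwp hwc x => ?_⟩
    · refine (hf.cover (e.symm y) (by simpa using hy)).imp (fun h1 => ?_) fun h1 => ?_
      · rw [h1]; simp
      · simpa using h1
    · simpa using hf.top_iff (e.symm x)
    · refine hf.other _ (fun h1 => hwp ?_) (fun h1 => hwc ?_) _
      · rw [← h1]; simp
      · rw [← h1]; simp

/-! ### Complete bipartite graphs -/

theorem completeBipartiteGraph_connected {α β : Type*} [Nonempty α] [Nonempty β] :
    (completeBipartiteGraph α β).Connected := by
  obtain ⟨a₀⟩ := ‹Nonempty α›
  obtain ⟨b₀⟩ := ‹Nonempty β›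
  have hr : ∀ b, (completeBipartiteGraph α β).Reachable (Sum.inl a₀) (Sum.inr b) := fun b =>
    SimpleGraph.Adj.reachable (by simp)
  rw [SimpleGraph.connected_iff_exists_forall_reachable]
  refine ⟨Sum.inl a₀, ?_⟩
  rintro (a | b)
  · exact (hr b₀).trans (SimpleGraph.Adj.reachable (by simp))
  · exact hr b

/-- Enlarging the left side of a complete bipartite graph by one vertex is adding a false twin. -/
def completeBipartiteGraphSuccIso (p q : ℕ) (i : Fin p) :
    completeBipartiteGraph (Fin (p + 1)) (Fin q) ≃g
      addFalseTwin (completeBipartiteGraph (Fin p) (Fin q)) (Sum.inl i) where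
  toFun := Sum.elim (Fin.cases none fun j => some (Sum.inl j)) fun j => some (Sum.inr j)
  invFun x := x.elim (Sum.inl 0) (Sum.map Fin.succ id)
  left_inv := by
    rintro (j | j)
    · refine Fin.cases ?_ (fun j => ?_) j <;> rfl
    · rfl
  right_inv := by
    rintro (_ | j | j) <;> rfl
  map_rel_iff' := by
    rintro (j | j) (k | k)
    · refine Fin.cases ?_ (fun j => ?_) j <;> refine Fin.cases ?_ (fun k => ?_) k <;>
        simp [addFalseTwin]
    · refine Fin.cases ?_ (fun j => ?_) j <;> simp [addFalseTwin]
    · refine Fin.cases ?_ (fun k => ?_) k <;> simp [addFalseTwin]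
    · simp [addFalseTwin]

theorem rotationGraph_completeBipartiteGraph_succ {p q : ℕ} (hp : 1 ≤ p) (hq : 1 ≤ q)
    (h : (rotationGraph (completeBipartiteGraph (Fin p) (Fin q))).Colorable 3) :
    (rotationGraph (completeBipartiteGraph (Fin (p + 1)) (Fin q))).Colorable 3 := by
  have : Nonempty (Fin p) := ⟨⟨0, hp⟩⟩
  have : Nonempty (Fin q) := ⟨⟨0, hq⟩⟩
  refine rotationGraph_colorable_of_iso (completeBipartiteGraphSuccIso p q ⟨0, hp⟩)
    completeBipartiteGraph_connected
    (rotationGraph_addFalseTwin_colorable completeBipartiteGraph_connected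
      ⟨Sum.inr ⟨0, hq⟩, by simp⟩ ?_ le_rfl h)
  rintro (x | x) (y | y) <;> simp

theorem rotationGraph_completeBipartiteGraph_swap {p q : ℕ} (hp : 1 ≤ p) (hq : 1 ≤ q)
    (h : (rotationGraph (completeBipartiteGraph (Fin p) (Fin q))).Colorable 3) :
    (rotationGraph (completeBipartiteGraph (Fin q) (Fin p))).Colorable 3 := by
  have : Nonempty (Fin p) := ⟨⟨0, hp⟩⟩
  have : Nonempty (Fin q) := ⟨⟨0, hq⟩⟩
  refine rotationGraph_colorable_of_iso (H := completeBipartiteGraph (Fin p) (Fin q))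
    ⟨Equiv.sumComm _ _, ?_⟩ completeBipartiteGraph_connected h
  rintro (x | x) (y | y) <;> simp

/-- The two search trees on a single edge are told apart by their root. -/
theorem rotationGraph_completeBipartiteGraph_one_one :
    (rotationGraph (completeBipartiteGraph (Fin 1) (Fin 1))).Colorable 3 := by
  classical
  have hG : (completeBipartiteGraph (Fin 1) (Fin 1)).Preconnected :=
    completeBipartiteGraph_connected.preconnected
  refine ⟨SimpleGraph.Coloring.mk
    (fun T => if T.Desc (Sum.inl 0) (Sum.inr 0) then 0 else 1) ?_⟩
  intro T T' hTT'
  obtain ⟨p, c, h⟩ := (rotationGraph_adj_iff hG).1 hTT'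
  have h1 := h.le
  have h2 := (h.symm (T.isSearchOrder hG) (T'.isSearchOrder hG)).le
  have h3 : ¬ T.Desc p c := fun h3 => h.ne ((T.isSearchOrder hG).antisymm _ _ h1 h3)
  have h4 : ¬ T'.Desc c p := fun h4 => h.ne ((T'.isSearchOrder hG).antisymm _ _ h4 h2)
  have hne := h.ne
  rcases p with p | p <;> rcases c with c | c <;> fin_cases p <;> fin_cases c <;> simp_all

theorem rotationGraph_completeBipartiteGraph_colorable {p q : ℕ} (hp : 1 ≤ p) (hq : 1 ≤ q) :
    (rotationGraph (completeBipartiteGraph (Fin p) (Fin q))).Colorable 3 := by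
  induction p, hp using Nat.le_induction with
  | base =>
    refine rotationGraph_completeBipartiteGraph_swap hq le_rfl ?_
    induction q, hq using Nat.le_induction with
    | base => exact rotationGraph_completeBipartiteGraph_one_one
    | succ q hq ih => exact rotationGraph_completeBipartiteGraph_succ hq le_rfl ih
  | succ p hp ih => exact rotationGraph_completeBipartiteGraph_succ hp hq ih

/-! ### Chromatic numbers -/

theorem three_le_of_rotationGraph_colorable {V : Type u} [Finite V] {G : SimpleGraph V}
    (hG : G.Connected) (hne : G ≠ ⊤) {n : ℕ} (h : (rotationGraph G).Colorable n) : 3 ≤ n := by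
  by_contra! hn
  exact not_colorable_two_rotationGraph hG hne (h.mono (by omega))

theorem mainTheorem3 :
    (∀ (V : Type u) [Finite V] (G : SimpleGraph V) (v : V),
      G.Connected → G ≠ ⊤ → G.IsUniversal v →
        (rotationGraph (addFalseTwin G v)).chromaticNumber =
          (rotationGraph G).chromaticNumber) ∧
    (∀ p q : ℕ, 1 ≤ p → 1 ≤ q → (2 ≤ p ∨ 2 ≤ q) →
      (rotationGraph (completeBipartiteGraph (Fin p) (Fin q))).chromaticNumber = 3) := by
  constructor
  · intro V _ G v hG hne huniv
    have hv : ∃ w, G.Adj v w := by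
      obtain ⟨a, b, hab, -⟩ := SimpleGraph.ne_top_iff_exists_not_adj.1 hne
      by_cases hva : v = a
      · exact ⟨b, huniv (hva ▸ hab)⟩
      · exact ⟨a, huniv hva⟩
    apply le_antisymm
    · refine SimpleGraph.chromaticNumber_le_of_forall_imp fun n hn =>
        rotationGraph_addFalseTwin_colorable hG hv (fun x y hx => ?_)
          (three_le_of_rotationGraph_colorable hG hne hn) hn
      by_cases hvy : v = y
      · exact Or.inr (Or.inr (hvy ▸ hx.symm))
      · exact Or.inr (Or.inl (huniv hvy))
    · exact SimpleGraph.chromaticNumber_le_of_forall_imp fun n hn =>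
        rotationGraph_colorable_of_addFalseTwin hG hv hn
  · intro p q hp hq hpq
    have : Nonempty (Fin p) := ⟨⟨0, hp⟩⟩
    have : Nonempty (Fin q) := ⟨⟨0, hq⟩⟩
    apply le_antisymm
    · exact (rotationGraph_completeBipartiteGraph_colorable hp hq).chromaticNumber_le
    · refine SimpleGraph.le_chromaticNumber_iff_colorable (n := 3).2 fun n hn => ?_
      have hne : completeBipartiteGraph (Fin p) (Fin q) ≠ ⊤ := by
        rw [SimpleGraph.ne_top_iff_exists_not_adj]
        rcases hpq with h | h
        · exact ⟨Sum.inl ⟨0, by omega⟩, Sum.inl ⟨1, by omega⟩, by simp, by simp⟩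
        · exact ⟨Sum.inr ⟨0, by omega⟩, Sum.inr ⟨1, by omega⟩, by simp, by simp⟩
      exact three_le_of_rotationGraph_colorable completeBipartiteGraph_connected hne hn
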